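/- Let $X$ be a metric space with its Borel $\sigma$-algebra and let $\sigma$ be a finite diffuse (i.e. $\sigma(\{x\})=0$ for all $x\in X$) Borel measure on $X$. Let $\Omega$ be the space of configurations on $X$, i.e. of Radon measures $\omega=\sum_{i=1}^{N}\delta_{x_i}$ with $N\in\mathbb N\cup\{\infty\}$ and pairwise distinct points $x_i\in X$; $\omega$ is identified with the set $\{x_i\}$. Equip $\Omega$ with the $\sigma$-algebra generated by the maps $\omega\mapsto\omega(B)$, $B$ Borel, and let $\pi$ be the Poisson measure with intensity $\sigma$ on $\Omega$, i.e. $$\pi\big(\omega(A_1)=k_1,\dots,\omega(A_n)=k_n\big)=\prod_{i=1}^n\frac{\sigma(A_i)^{k_i}}{k_i!}e^{-\sigma(A_i)}$$ for all disjoint Borel sets $A_1,\dots,A_n\subset X$ and all $k_1,\dots,k_n\in\mathbb N$; let $E$ denote expectation under $\pi$. For $F:\Omega\to\mathbb R$ let $$D_xF(\omega)=\big(F(\omega)-F(\omega+\delta_x)\big)1_{\{x\notin\omega\}}+\big(F(\omega)-F(\omega-\delta_x)\big)1_{\{x\in\omega\}},\qquad |DF|_{L^2(\sigma)}^2(\omega)=\int_X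 |D_xF(\omega)|^2\,\sigma(dx).$$ Let $I(t)=\varphi(\Phi^{-1}(t))$ for $0<t<1$ and $I(0)=I(1)=0$, where $\varphi$ and $\Phi$ are the standard Gaussian density and distribution function. Then for every random variable (measurable function) $F:\Omega\to[0,1]$, $$I(E[F])\le E\left[\sqrt{I(F)^2+2\,|DF|_{L^2(\sigma)}^2}\right].$$ -/

import Mathlib

open MeasureTheory ProbabilityTheory Topology

noncomputable section

/-- A configuration in `X`: a countable, locally finite set of points of `X`. It is identified with
the Radon point measure `∑_{x ∈ points} δ_x`, see `Configuration.toMeasure`. -/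
@[ext]
structure Configuration (X : Type*) [TopologicalSpace X] where
  points : Set X
  countable_points : points.Countable
  locallyFinite_points : ∀ x : X, ∃ U ∈ 𝓝 x, (points ∩ U).Finite

namespace Configuration

section Topological

variable {X : Type*} [TopologicalSpace X]

/-- The configuration `ω + δ_x`, for `x ∉ ω`. -/
def addPoint (ω : Configuration X) (x : X) : Configuration X where
  points := insert x ω.points
  countable_points := ω.countable_points.insert x
  locallyFinite_points := fun y => by
    obtain ⟨U, hU, hf⟩ := ω.locallyFinite_points y
    refine ⟨U, hU, (hf.insert x).subset ?_⟩
    rintro z ⟨hz | hz, hzU⟩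
    · exact Or.inl hz
    · exact Or.inr ⟨hz, hzU⟩

/-- The configuration `ω - δ_x`, for `x ∈ ω`. -/
def removePoint (ω : Configuration X) (x : X) : Configuration X where
  points := ω.points \ {x}
  countable_points := ω.countable_points.mono Set.sdiff_subset
  locallyFinite_points := fun y => by
    obtain ⟨U, hU, hf⟩ := ω.locallyFinite_points y
    exact ⟨U, hU, hf.subset (Set.inter_subset_inter_left U Set.sdiff_subset)⟩

open Classical in
/-- The finite difference gradient
`D_x F(ω) = (F(ω) - F(ω + δ_x)) 1_{x ∉ ω} + (F(ω) - F(ω - δ_x)) 1_{x ∈ ω}`. -/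
def gradient (F : Configuration X → ℝ) (ω : Configuration X) (x : X) : ℝ :=
  if x ∈ ω.points then F ω - F (ω.removePoint x) else F ω - F (ω.addPoint x)

end Topological

section Measurable

variable {X : Type*} [TopologicalSpace X] [MeasurableSpace X]

/-- The point measure `∑_{x ∈ ω} δ_x`. -/
def toMeasure (ω : Configuration X) : Measure X :=
  Measure.sum fun x : ω.points => Measure.dirac (x : X)

/-- The σ-algebra on configurations generated by the maps `ω ↦ ω(B)`, `B` measurable. -/
instance : MeasurableSpace (Configuration X) :=
  ⨆ (B : Set X) (_ : MeasurableSet B),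
    MeasurableSpace.comap (fun ω : Configuration X => ω.toMeasure B) inferInstance

/-- `π` is the Poisson measure with intensity `σ`: the counts of disjoint measurable sets
`A_1, …, A_n` are independent Poisson variables with parameters `σ(A_1), …, σ(A_n)`. This
determines `π` (the case `n = 0` says that `π` has total mass one). -/
def IsPoissonMeasure (σ : Measure X) (π : Measure (Configuration X)) : Prop :=
  ∀ (n : ℕ) (A : Fin n → Set X), (∀ i, MeasurableSet (A i)) →
    (Pairwise fun i j => Disjoint (A i) (A j)) → ∀ k : Fin n → ℕ,
      π {ω | ∀ i, ω.toMeasure (A i) = (k i : ENNReal)} =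
        ENNReal.ofReal
          (∏ i, σ.real (A i) ^ k i / (Nat.factorial (k i) : ℝ) * Real.exp (-σ.real (A i)))

/-- `ω(B)` is the number of points of `ω` in `B`. -/
theorem toMeasure_apply (ω : Configuration X) {B : Set X} (hB : MeasurableSet B) :
    ω.toMeasure B = ((ω.points ∩ B).encard : ENNReal) := by
  classical
  rw [toMeasure, Measure.sum_apply _ hB]
  simp only [Measure.dirac_apply' _ hB]
  have h : ∀ x : ω.points, B.indicator (1 : X → ENNReal) x =
      (Subtype.val ⁻¹' B : Set ω.points).indicator (fun _ => 1) x := fun x => rfl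
  simp only [h]
  rw [← tsum_subtype, ENNReal.tsum_set_one]
  congr 1
  rw [← Subtype.val_injective.encard_image, Subtype.image_preimage_coe]

end Measurable

end Configuration

/-- The standard Gaussian distribution function `Φ`. -/
def gaussianCDF : ℝ → ℝ := fun x => cdf (gaussianReal 0 1) x

open Classical in
/-- The Gaussian isoperimetric function `I = φ ∘ Φ⁻¹` on `[0,1]`, where `φ` is the standard
Gaussian density. `Φ` is a bijection from `ℝ` onto `(0,1)`; as usual `I(0) = I(1) = 0`
(that is, `Φ⁻¹(0) = -∞`, `Φ⁻¹(1) = +∞` and `φ(±∞) = 0`). -/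
def gaussianIsoperimetric (t : ℝ) : ℝ :=
  if t ∈ Set.Ioo (0 : ℝ) 1 then gaussianPDFReal 0 1 (Function.invFun gaussianCDF t) else 0

end

/-!
The inequality is proved for every compound Poisson law and then transferred to configurations.

Let `ν` be a finite measure on a commutative monoid `M` and let a chain start at `0` and, in each
step, add a jump `y` with probability `h ν(dy)`. For a function `g` put
`J_t g = √(I(g)² + 2 t ∫ (g(· + y) - g)² ν(dy))` and let `Q` be the transition operator of the
chain. Then `J_t (Q g) ≤ Q (J_{t+h} g) + O(h²)` (`BoundedMeasurable.interpolant_jumpStep_le`). Since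
`Q` commutes with increments, the Cauchy-Schwarz inequality in `ℝ × L²(ν)` reduces this to the case
`t = 0`, and there it amounts to the two-point inequality
`I(a) (I(a) + I'(a) (b - a) - I(b)) ≤ (b - a)²`
together with the concavity of `I` (`exists_gaussianIsoperimetric_tangent`). The constant `2` of the
theorem is twice the constant of the two-point inequality, which is obtained by differentiating in
the Gaussian quantile of `a` (`gaussian_gap_le`). Taking `n` steps with `h = 1 / n` and letting
`n → ∞`, the law of the chain converges to the compound Poisson law
(`BoundedMeasurable.tendsto_jumpStep_pow`) and the errors vanish, which gives
`gaussianIsoperimetric_integral_compoundPoisson_le`; the error terms are uniform only when the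
values of `g` stay away from `0` and `1`, and the continuity of `I` removes this restriction.

A configuration is encoded by its counts in all measurable sets, and adding a point becomes adding a
vector. By the uniqueness of characteristic functions, the counts of a Poisson measure follow the
compound Poisson law whose jumps are single points
(`Configuration.IsPoissonMeasure.map_counts`). As `σ` has no point masses, the points of a
configuration do not contribute to the norm of the gradient, and increments of functions of the
counts are gradients. No separability of `X` is needed: measurability in the point added is read
off from the counts.
-/

/-! ### The Gaussian isoperimetric function -/

theorem hasDerivAt_gaussianPDFReal (x : ℝ) :
    HasDerivAt (gaussianPDFReal 0 1) (-x * gaussianPDFReal 0 1 x) x := by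
  rw [gaussianPDFReal_def]
  have h : HasDerivAt (fun x : ℝ => -(x - 0) ^ 2 / (2 * ((1 : NNReal) : ℝ))) (-x) x := by
    refine ((((hasDerivAt_id x).sub_const 0).pow 2).neg.div_const
      (2 * ((1 : NNReal) : ℝ))).congr_deriv ?_
    simp only [id, NNReal.coe_one]
    push_cast
    ring
  exact (h.exp.const_mul _).congr_deriv (by ring)

theorem continuous_gaussianPDFReal : Continuous (gaussianPDFReal 0 1) :=
  continuous_iff_continuousAt.2 fun x => (hasDerivAt_gaussianPDFReal x).continuousAt

theorem hasDerivAt_gaussianCDF (x : ℝ) :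
    HasDerivAt gaussianCDF (gaussianPDFReal 0 1 x) x := by
  have hi := integrable_gaussianPDFReal 0 1
  have key : ∀ y, gaussianCDF y =
      (∫ z in Set.Iic 0, gaussianPDFReal 0 1 z) + ∫ z in (0 : ℝ)..y, gaussianPDFReal 0 1 z := by
    intro y
    rw [gaussianCDF, cdf_eq_real, measureReal_def, gaussianReal_apply_eq_integral _ one_ne_zero,
      ENNReal.toReal_ofReal (integral_nonneg fun _ => gaussianPDFReal_nonneg _ _ _),
      ← intervalIntegral.integral_Iic_sub_Iic hi.integrableOn hi.integrableOn,
      add_sub_cancel]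
  rw [funext key]
  exact (intervalIntegral.integral_hasDerivAt_right hi.intervalIntegrable
    continuous_gaussianPDFReal.stronglyMeasurable.stronglyMeasurableAtFilter
    continuous_gaussianPDFReal.continuousAt).const_add _

theorem continuous_gaussianCDF : Continuous gaussianCDF :=
  continuous_iff_continuousAt.2 fun x => (hasDerivAt_gaussianCDF x).continuousAt

theorem strictMono_gaussianCDF : StrictMono gaussianCDF :=
  strictMono_of_hasDerivAt_pos hasDerivAt_gaussianCDF
    fun x => gaussianPDFReal_pos 0 1 x one_ne_zero

theorem gaussianCDF_mem_Ioo (x : ℝ) : gaussianCDF x ∈ Set.Ioo (0 : ℝ) 1 :=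
  ⟨(cdf_nonneg _ _).trans_lt (strictMono_gaussianCDF (sub_one_lt x)),
    (strictMono_gaussianCDF (lt_add_one x)).trans_le (cdf_le_one _ _)⟩

theorem exists_gaussianCDF_eq {t : ℝ} (ht : t ∈ Set.Ioo (0 : ℝ) 1) : ∃ x, gaussianCDF x = t := by
  obtain ⟨a, ha⟩ := ((tendsto_cdf_atBot (gaussianReal 0 1)).eventually_lt_const ht.1).exists
  obtain ⟨b, hb⟩ := ((tendsto_cdf_atTop (gaussianReal 0 1)).eventually_const_lt ht.2).exists
  exact mem_range_of_exists_le_of_exists_ge continuous_gaussianCDF ⟨a, ha.le⟩ ⟨b, hb.le⟩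

theorem gaussianIsoperimetric_gaussianCDF (x : ℝ) :
    gaussianIsoperimetric (gaussianCDF x) = gaussianPDFReal 0 1 x := by
  rw [gaussianIsoperimetric, if_pos (gaussianCDF_mem_Ioo x),
    Function.leftInverse_invFun strictMono_gaussianCDF.injective x]

theorem gaussianIsoperimetric_of_notMem {t : ℝ} (ht : t ∉ Set.Ioo (0 : ℝ) 1) :
    gaussianIsoperimetric t = 0 := if_neg ht

theorem gaussianIsoperimetric_pos {t : ℝ} (ht : t ∈ Set.Ioo (0 : ℝ) 1) :
    0 < gaussianIsoperimetric t := by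
  obtain ⟨x, rfl⟩ := exists_gaussianCDF_eq ht
  rw [gaussianIsoperimetric_gaussianCDF]
  exact gaussianPDFReal_pos _ _ _ one_ne_zero

theorem gaussianIsoperimetric_nonneg (t : ℝ) : 0 ≤ gaussianIsoperimetric t := by
  by_cases ht : t ∈ Set.Ioo (0 : ℝ) 1
  · exact (gaussianIsoperimetric_pos ht).le
  · rw [gaussianIsoperimetric_of_notMem ht]

theorem gaussianPDFReal_le_of_sq_le {x y : ℝ} (h : x ^ 2 ≤ y ^ 2) :
    gaussianPDFReal 0 1 y ≤ gaussianPDFReal 0 1 x := by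
  simp only [gaussianPDFReal]
  gcongr ?_ * Real.exp ?_
  simp only [sub_zero, NNReal.coe_one]
  linarith

theorem gaussianPDFReal_le_one (x : ℝ) : gaussianPDFReal 0 1 x ≤ 1 := by
  refine (gaussianPDFReal_le_of_sq_le (x := 0) (by simp [sq_nonneg])).trans ?_
  simp only [gaussianPDFReal]
  have : (1 : ℝ) ≤ √(2 * Real.pi * ((1 : NNReal) : ℝ)) := by
    rw [Real.one_le_sqrt, NNReal.coe_one]
    linarith [Real.pi_gt_three]
  simpa using inv_le_one_of_one_le₀ this

theorem gaussianIsoperimetric_le_one (t : ℝ) : gaussianIsoperimetric t ≤ 1 := by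
  by_cases ht : t ∈ Set.Ioo (0 : ℝ) 1
  · obtain ⟨x, rfl⟩ := exists_gaussianCDF_eq ht
    rw [gaussianIsoperimetric_gaussianCDF]
    exact gaussianPDFReal_le_one x
  · rw [gaussianIsoperimetric_of_notMem ht]
    exact zero_le_one

theorem tendsto_gaussianPDFReal_atTop :
    Filter.Tendsto (gaussianPDFReal 0 1) Filter.atTop (𝓝 0) := by
  have h : Filter.Tendsto (fun x : ℝ => x ^ 2 / 2) Filter.atTop Filter.atTop :=
    (Filter.tendsto_pow_atTop two_ne_zero).atTop_div_const two_pos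
  have := (Real.tendsto_exp_neg_atTop_nhds_zero.comp h).const_mul
    (√(2 * Real.pi * ((1 : NNReal) : ℝ)))⁻¹
  rw [mul_zero] at this
  refine this.congr fun x => ?_
  simp [gaussianPDFReal, neg_div]

/-- At the end points `0` and `1` this is the decay of the Gaussian density at infinity. -/
theorem continuous_gaussianIsoperimetric : Continuous gaussianIsoperimetric := by
  rw [continuous_iff_continuousAt]
  intro t
  by_cases ht : t ∈ Set.Ioo (0 : ℝ) 1
  · let e : ℝ ≃o Set.Ioo (0 : ℝ) 1 := StrictMono.orderIsoOfSurjective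
      (fun x => ⟨gaussianCDF x, gaussianCDF_mem_Ioo x⟩) (fun x y h => strictMono_gaussianCDF h)
      fun ⟨s, hs⟩ => (exists_gaussianCDF_eq hs).imp fun x hx => Subtype.ext hx
    have hc : Continuous fun s : Set.Ioo (0 : ℝ) 1 => gaussianIsoperimetric s := by
      have : (fun s : Set.Ioo (0 : ℝ) 1 => gaussianIsoperimetric s) =
          fun s => gaussianPDFReal 0 1 (e.symm s) := by
        funext s
        have hs : (s : ℝ) = gaussianCDF (e.symm s) := by
          conv_lhs => rw [← e.apply_symm_apply s]
          rfl
        conv_lhs => rw [hs]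
        exact gaussianIsoperimetric_gaussianCDF _
      rw [this]
      exact continuous_gaussianPDFReal.comp e.toHomeomorph.symm.continuous
    exact (continuousOn_iff_continuous_domRestrict.2 hc).continuousAt (isOpen_Ioo.mem_nhds ht)
  · rw [ContinuousAt, gaussianIsoperimetric_of_notMem ht, Metric.tendsto_nhds]
    intro ε hε
    obtain ⟨M, hM, hM0⟩ := ((tendsto_gaussianPDFReal_atTop.eventually_lt_const hε).and
      (Filter.eventually_ge_atTop 0)).exists
    -- Outside `[Φ(-M), Φ(M)]` the function is at most `φ(M) < ε`.
    have key : ∀ s, s < gaussianCDF (-M) ∨ gaussianCDF M < s →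
        dist (gaussianIsoperimetric s) 0 < ε := by
      intro s hs
      rw [Real.dist_0_eq_abs, abs_of_nonneg (gaussianIsoperimetric_nonneg s)]
      by_cases hs1 : s ∈ Set.Ioo (0 : ℝ) 1
      · obtain ⟨x, rfl⟩ := exists_gaussianCDF_eq hs1
        rw [gaussianIsoperimetric_gaussianCDF]
        refine (gaussianPDFReal_le_of_sq_le ?_).trans_lt hM
        rw [strictMono_gaussianCDF.lt_iff_lt, strictMono_gaussianCDF.lt_iff_lt] at hs
        rcases hs with hs | hs <;> nlinarith
      · rwa [gaussianIsoperimetric_of_notMem hs1]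
    rw [Set.mem_Ioo, not_and_or, not_lt, not_lt] at ht
    rcases ht with ht | ht
    · filter_upwards [Iio_mem_nhds (ht.trans_lt (gaussianCDF_mem_Ioo (-M)).1)] with s hs
      exact key s (Or.inl hs)
    · filter_upwards [Ioi_mem_nhds ((gaussianCDF_mem_Ioo M).2.trans_le ht)] with s hs
      exact key s (Or.inr hs)

/-- A function whose derivative at `x` has the sign of `x - y` has its minimum at `y`. -/
theorem le_of_hasDerivAt_sign {u u' : ℝ → ℝ} {y : ℝ} (hu : ∀ x, HasDerivAt u (u' x) x)
    (hl : ∀ x ≤ y, u' x ≤ 0) (hr : ∀ x, y ≤ x → 0 ≤ u' x) (x : ℝ) : u y ≤ u x := by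
  have hc : Continuous u := continuous_iff_continuousAt.2 fun x => (hu x).continuousAt
  rcases le_total x y with h | h
  · refine antitoneOn_of_deriv_nonpos (convex_Iic y) hc.continuousOn
      (fun z _ => (hu z).differentiableAt.differentiableWithinAt) (fun z hz => ?_) h
      (Set.mem_Iic.2 le_rfl) h
    rw [(hu z).deriv]
    exact hl z (interior_subset (s := Set.Iic y) hz)
  · refine monotoneOn_of_deriv_nonneg (convex_Ici y) hc.continuousOn
      (fun z _ => (hu z).differentiableAt.differentiableWithinAt) (fun z hz => ?_)
      (Set.mem_Ici.2 le_rfl) h h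
    rw [(hu z).deriv]
    exact hr z (interior_subset (s := Set.Ici y) hz)

/-- The derivative, in the point of tangency, of the gap at `Φ(y)` between the isoperimetric
function and its tangent at `Φ(x)`. -/
theorem hasDerivAt_gaussian_gap (y x : ℝ) :
    HasDerivAt (fun x => gaussianPDFReal 0 1 x - gaussianPDFReal 0 1 y -
      x * (gaussianCDF y - gaussianCDF x)) (-(gaussianCDF y - gaussianCDF x)) x := by
  refine (((hasDerivAt_gaussianPDFReal x).sub_const (gaussianPDFReal 0 1 y)).sub
    ((hasDerivAt_id x).mul
      ((hasDerivAt_gaussianCDF x).const_sub (gaussianCDF y)))).congr_deriv ?_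
  simp only [id]
  ring

/-- The tangent to the isoperimetric function at `Φ(x)`, whose slope is `-x`, lies above its
graph. -/
theorem gaussian_gap_nonneg (x y : ℝ) :
    0 ≤ gaussianPDFReal 0 1 x - gaussianPDFReal 0 1 y - x * (gaussianCDF y - gaussianCDF x) := by
  have := le_of_hasDerivAt_sign (y := y) (hasDerivAt_gaussian_gap y)
    (fun x hx => by linarith [strictMono_gaussianCDF.monotone hx])
    (fun x hx => by linarith [strictMono_gaussianCDF.monotone hx]) x
  simpa using this

/-- The gap between the isoperimetric function and its tangent is at most quadratic. With
`m = Φ(y) - Φ(x)` and `k` the gap, `u = m² - φ(x) k` and `v = m - x k` satisfy, as functions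
of `x`, `u' = -φ v` and `v' = -2 k - φ(y) ≤ 0`, and both vanish at `x = y`. -/
theorem gaussian_gap_le (x y : ℝ) :
    gaussianPDFReal 0 1 x *
      (gaussianPDFReal 0 1 x - gaussianPDFReal 0 1 y - x * (gaussianCDF y - gaussianCDF x)) ≤
    (gaussianCDF y - gaussianCDF x) ^ 2 := by
  set k : ℝ → ℝ := fun x => gaussianPDFReal 0 1 x - gaussianPDFReal 0 1 y -
    x * (gaussianCDF y - gaussianCDF x) with hk
  have hk' : ∀ x, HasDerivAt k (-(gaussianCDF y - gaussianCDF x)) x := hasDerivAt_gaussian_gap y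
  have hm' : ∀ x, HasDerivAt (fun x => gaussianCDF y - gaussianCDF x) (-gaussianPDFReal 0 1 x) x :=
    fun x => (hasDerivAt_gaussianCDF x).const_sub _
  have hv' : ∀ x, HasDerivAt (fun x => gaussianCDF y - gaussianCDF x - x * k x)
      (-2 * k x - gaussianPDFReal 0 1 y) x := fun x => by
    refine ((hm' x).sub ((hasDerivAt_id x).mul (hk' x))).congr_deriv ?_
    simp only [hk, id]
    ring
  have hv : Antitone fun x => gaussianCDF y - gaussianCDF x - x * k x :=
    antitone_of_hasDerivAt_nonpos hv' fun x => by
      have h1 : 0 ≤ k x := gaussian_gap_nonneg x y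
      have h2 := gaussianPDFReal_nonneg 0 1 y
      show -2 * k x - gaussianPDFReal 0 1 y ≤ 0
      linarith
  have hv0 : gaussianCDF y - gaussianCDF y - y * k y = 0 := by simp [hk]
  have hu' : ∀ x, HasDerivAt
      (fun x => (gaussianCDF y - gaussianCDF x) ^ 2 - gaussianPDFReal 0 1 x * k x)
      (-gaussianPDFReal 0 1 x * (gaussianCDF y - gaussianCDF x - x * k x)) x := fun x => by
    refine (((hm' x).pow 2).sub ((hasDerivAt_gaussianPDFReal x).mul (hk' x))).congr_deriv ?_
    push_cast
    ring
  have := le_of_hasDerivAt_sign (y := y) hu'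
    (fun x hx => by
      have h1 := hv hx
      have h2 := gaussianPDFReal_nonneg 0 1 x
      have h3 : 0 ≤ gaussianCDF y - gaussianCDF x - x * k x := by linarith
      nlinarith)
    (fun x hx => by
      have h1 := hv hx
      have h2 := gaussianPDFReal_nonneg 0 1 x
      have h3 : gaussianCDF y - gaussianCDF x - x * k x ≤ 0 := by linarith
      nlinarith) x
  simp only [hk, sub_self, mul_zero] at this
  simpa [hk] using this

/-- The isoperimetric function lies below its tangents, by at most a quadratic amount. The number
`c` is the derivative of the isoperimetric function at `a`. -/
theorem exists_gaussianIsoperimetric_tangent {a : ℝ} (ha : a ∈ Set.Ioo (0 : ℝ) 1) :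
    ∃ c : ℝ, ∀ b ∈ Set.Ioo (0 : ℝ) 1,
      gaussianIsoperimetric b ≤ gaussianIsoperimetric a + c * (b - a) ∧
      gaussianIsoperimetric a * (gaussianIsoperimetric a + c * (b - a) - gaussianIsoperimetric b) ≤
        (b - a) ^ 2 := by
  obtain ⟨x, rfl⟩ := exists_gaussianCDF_eq ha
  refine ⟨-x, fun b hb => ?_⟩
  obtain ⟨y, rfl⟩ := exists_gaussianCDF_eq hb
  simp only [gaussianIsoperimetric_gaussianCDF]
  refine ⟨by linarith [gaussian_gap_nonneg x y], le_of_eq_of_le ?_ (gaussian_gap_le x y)⟩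
  ring

/-! ### One step of the interpolation -/

theorem Measurable.integrable_of_abs_le {α : Type*} [MeasurableSpace α] {μ : Measure α}
    [IsFiniteMeasure μ] {f : α → ℝ} (hf : Measurable f) {C : ℝ} (hC : ∀ x, |f x| ≤ C) :
    Integrable f μ :=
  Integrable.of_bound hf.aestronglyMeasurable C (Filter.Eventually.of_forall hC)

/-- The second order Taylor polynomial of `v ↦ √(u² + 2 v)` at `0` is a lower bound. -/
theorem add_div_sub_le_sqrt {u v : ℝ} (hu : 0 < u) (hv : 0 ≤ v) :
    u + v / u - v ^ 2 / (2 * u ^ 3) ≤ √(u ^ 2 + 2 * v) := by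
  set w := √(u ^ 2 + 2 * v) with hw
  have hw2 : w ^ 2 = u ^ 2 + 2 * v := Real.sq_sqrt (by positivity)
  have huw : u ≤ w := Real.le_sqrt_of_sq_le (by linarith)
  obtain ⟨z, rfl⟩ : ∃ z, v = u * z := ⟨v / u, by field_simp⟩
  have hz : 0 ≤ z := nonneg_of_mul_nonneg_right hv hu
  have h1 : u * z / u = z := by field_simp
  have h2 : (u * z) ^ 2 / (2 * u ^ 3) = z ^ 2 / (2 * u) := by field_simp
  rw [h1, h2]
  -- `w - u = 2 u z / (w + u)`, so `w - u ≤ z` and `u + z - w = z (w - u) / (w + u)`.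
  have h3 : w - u ≤ z := by nlinarith
  have h4 : (u + z - w) * (w + u) = z * (w - u) := by linear_combination (-1 : ℝ) * hw2
  have h5 : u + z - w ≤ z ^ 2 / (2 * u) := by
    rw [le_div_iff₀ (by positivity)]
    nlinarith [mul_le_mul_of_nonneg_left h3 hz]
  linarith

/-- The Cauchy-Schwarz inequality in `ℝ × L²(ν)`. -/
theorem add_integral_le_sqrt_mul_sqrt {Y : Type*} [MeasurableSpace Y] {ν : Measure Y}
    {f k : Y → ℝ} (hf : Integrable (fun y => f y ^ 2) ν)
    (hk : Integrable (fun y => k y ^ 2) ν) (hfk : Integrable (fun y => f y * k y) ν)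
    {α β t : ℝ} (hα : 0 < α) (hβ : 0 < β) (ht : 0 ≤ t) :
    α * β + 2 * t * ∫ y, f y * k y ∂ν ≤
      √(α ^ 2 + 2 * t * ∫ y, f y ^ 2 ∂ν) * √(β ^ 2 + 2 * t * ∫ y, k y ^ 2 ∂ν) := by
  have hf0 : 0 ≤ ∫ y, f y ^ 2 ∂ν := integral_nonneg fun y => sq_nonneg _
  have hk0 : 0 ≤ ∫ y, k y ^ 2 ∂ν := integral_nonneg fun y => sq_nonneg _
  have hx : 0 < α ^ 2 + 2 * t * ∫ y, f y ^ 2 ∂ν := by positivity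
  have hy : 0 < β ^ 2 + 2 * t * ∫ y, k y ^ 2 ∂ν := by positivity
  have hx2 := Real.sq_sqrt hx.le
  have hy2 := Real.sq_sqrt hy.le
  have hx' := Real.sqrt_pos.2 hx
  have hy' := Real.sqrt_pos.2 hy
  set x := √(α ^ 2 + 2 * t * ∫ y, f y ^ 2 ∂ν)
  set y := √(β ^ 2 + 2 * t * ∫ y, k y ^ 2 ∂ν)
  -- With `x, y > 0` the two norms, integrate the square of `y (α, f) - x (β, k)`.
  have h1 : 0 ≤ ∫ z, (y * f z - x * k z) ^ 2 ∂ν := integral_nonneg fun z => sq_nonneg _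
  have h2 : ∫ z, (y * f z - x * k z) ^ 2 ∂ν =
      y ^ 2 * (∫ z, f z ^ 2 ∂ν) - 2 * x * y * (∫ z, f z * k z ∂ν) + x ^ 2 * ∫ z, k z ^ 2 ∂ν := by
    have hsub : Integrable (fun z => y ^ 2 * f z ^ 2 - 2 * x * y * (f z * k z)) ν :=
      (hf.const_mul _).sub (hfk.const_mul _)
    rw [← integral_const_mul, ← integral_const_mul, ← integral_const_mul,
      ← integral_sub (hf.const_mul _) (hfk.const_mul _),
      ← integral_add hsub (hk.const_mul _)]
    congr 1
    funext z
    ring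
  have h3 : 0 ≤ (x * y) * (x * y - (α * β + 2 * t * ∫ z, f z * k z ∂ν)) := by
    have h4 := mul_nonneg ht h1
    rw [h2] at h4
    nlinarith [sq_nonneg (y * α - x * β)]
  have := nonneg_of_mul_nonneg_right h3 (mul_pos hx' hy')
  linarith

section Step

variable {Y : Type*} [MeasurableSpace Y] (ν : Measure Y) [IsFiniteMeasure ν]

/-- The infinitesimal form of the inequality: a chain which jumps from the value `a` to `b y` with
probability `h ν(dy)` satisfies it up to an error of order `h²`, uniformly in `a` and `b` with
values in a set `S` on which the isoperimetric function is bounded below. -/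
theorem gaussianIsoperimetric_jump_le {S : Set ℝ} (hS : S ⊆ Set.Ioo 0 1) {κ : ℝ} (hκ : 0 < κ)
    (hκS : ∀ a ∈ S, κ ≤ gaussianIsoperimetric a) {a : ℝ} (ha : a ∈ S) {b : Y → ℝ}
    (hb : Measurable b) (hbS : ∀ y, b y ∈ S) {h : ℝ} (h0 : 0 ≤ h) (h1 : h * ν.real Set.univ ≤ 1)
    (hm : (1 - h * ν.real Set.univ) * a + h * ∫ y, b y ∂ν ∈ Set.Ioo (0 : ℝ) 1) :
    gaussianIsoperimetric ((1 - h * ν.real Set.univ) * a + h * ∫ y, b y ∂ν) ≤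
      (1 - h * ν.real Set.univ) * √(gaussianIsoperimetric a ^ 2 + 2 * h * ∫ y, (b y - a) ^ 2 ∂ν) +
        h * ∫ y, gaussianIsoperimetric (b y) ∂ν +
        (ν.real Set.univ ^ 2 / κ + ν.real Set.univ ^ 2 / (2 * κ ^ 3)) * h ^ 2 := by
  obtain ⟨c, hc⟩ := exists_gaussianIsoperimetric_tangent (hS ha)
  set s := ν.real Set.univ with hs
  set u := gaussianIsoperimetric a with hu
  have hs0 : 0 ≤ s := measureReal_nonneg
  have hu0 : κ ≤ u := hκS a ha
  have hupos : 0 < u := hκ.trans_le hu0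
  have hba : ∀ y, |b y - a| ≤ 1 := fun y => by
    have h2 := hS (hbS y)
    have h3 := hS ha
    exact abs_le.2 ⟨by linarith [h2.1, h3.2], by linarith [h2.2, h3.1]⟩
  have hba2 : ∀ y, (b y - a) ^ 2 ≤ 1 := fun y => (sq_le_one_iff_abs_le_one _).2 (hba y)
  have ib : Integrable b ν := hb.integrable_of_abs_le (C := 1) fun y =>
    abs_le.2 ⟨by linarith [(hS (hbS y)).1], (hS (hbS y)).2.le⟩
  have iba : Integrable (fun y => b y - a) ν := ib.sub (integrable_const a)
  have isq : Integrable (fun y => (b y - a) ^ 2) ν :=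
    ((hb.sub_const a).pow_const 2).integrable_of_abs_le (C := 1) fun y => by
      rw [abs_of_nonneg (sq_nonneg _)]; exact hba2 y
  have iI : Integrable (fun y => gaussianIsoperimetric (b y)) ν :=
    (continuous_gaussianIsoperimetric.measurable.comp hb).integrable_of_abs_le (C := 1) fun y => by
      simp only [Function.comp]
      rw [abs_of_nonneg (gaussianIsoperimetric_nonneg _)]
      exact gaussianIsoperimetric_le_one _
  set V := ∫ y, (b y - a) ^ 2 ∂ν with hV
  set K := ∫ y, gaussianIsoperimetric (b y) ∂ν with hK
  have hV0 : 0 ≤ V := integral_nonneg fun y => sq_nonneg _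
  have hVs : V ≤ s := by
    have := integral_mono isq (integrable_const (1 : ℝ)) hba2
    simpa [hs] using this
  have hD : ∫ y, (b y - a) ∂ν = (∫ y, b y ∂ν) - s * a := by
    rw [integral_sub ib (integrable_const a), integral_const, smul_eq_mul]
  set D := ∫ y, (b y - a) ∂ν with hD'
  -- the mean after one step is `a + h D`, and the tangent at `a` bounds its image
  have hcomb : (1 - h * s) * a + h * ∫ y, b y ∂ν = a + h * D := by rw [hD]; ring
  rw [hcomb] at hm ⊢
  have e1 := (hc _ hm).1
  -- integrate the quadratic lower bound over the jumps
  have e2 : u * (u * s + c * D - K) ≤ V := by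
    have hadd : Integrable (fun y => u + c * (b y - a)) ν :=
      (integrable_const u).add (iba.const_mul c)
    have := integral_mono ((hadd.sub iI).const_mul u) isq fun y => (hc (b y) (hS (hbS y))).2
    simp only [Pi.sub_apply] at this
    rw [integral_const_mul, integral_sub hadd iI,
      integral_add (integrable_const u) (iba.const_mul c), integral_const, integral_const_mul,
      smul_eq_mul] at this
    rw [mul_comm u s]
    exact this
  have e3 : u * s + c * D - V / u ≤ K := by
    have : u * s + c * D - K ≤ V / u := by rw [le_div_iff₀ hupos, mul_comm]; exact e2
    linarith
  have e4 := add_div_sub_le_sqrt hupos (mul_nonneg h0 hV0)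
  rw [← mul_assoc] at e4
  have e5 : (h * V) ^ 2 / (2 * u ^ 3) ≤ s ^ 2 / (2 * κ ^ 3) * h ^ 2 := by
    rw [mul_pow, mul_comm (h ^ 2), mul_div_right_comm]
    gcongr
  have e6 : h * s * (h * V / u) ≤ s ^ 2 / κ * h ^ 2 := by
    have : V / u ≤ s / κ := by gcongr
    calc h * s * (h * V / u) = h ^ 2 * s * (V / u) := by ring
      _ ≤ h ^ 2 * s * (s / κ) := by gcongr
      _ = s ^ 2 / κ * h ^ 2 := by ring
  have e7 := mul_le_mul_of_nonneg_left e4 (sub_nonneg.2 h1)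
  have e8 := mul_le_mul_of_nonneg_left e3 h0
  have e9 : 0 ≤ h * s * ((h * V) ^ 2 / (2 * u ^ 3)) := by positivity
  have e10 : h * (V / u) = h * V / u := by ring
  nlinarith

end Step

/-! ### Jump dynamics on an additive monoid -/

/-- The bounded measurable real functions on `M`, as a submodule of all functions. -/
def boundedMeasurable (M : Type*) [MeasurableSpace M] : Submodule ℝ (M → ℝ) where
  carrier := {g | Measurable g ∧ ∃ C, ∀ m, |g m| ≤ C}
  add_mem' := by
    rintro f g ⟨hf, C, hC⟩ ⟨hg, D, hD⟩
    exact ⟨hf.add hg, C + D, fun m => (abs_add_le _ _).trans (add_le_add (hC m) (hD m))⟩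
  zero_mem' := ⟨measurable_const, 0, fun m => by simp⟩
  smul_mem' := by
    rintro c f ⟨hf, C, hC⟩
    refine ⟨hf.const_smul c, |c| * C, fun m => ?_⟩
    rw [Pi.smul_apply, smul_eq_mul, abs_mul]
    exact mul_le_mul_of_nonneg_left (hC m) (abs_nonneg c)

/-- The type of bounded measurable real functions on `M`. -/
def BoundedMeasurable (M : Type*) [MeasurableSpace M] : Type _ := boundedMeasurable M

theorem Measurable.measurable_integral_add {M : Type*} [AddCommMonoid M]
    [MeasurableSpace M] [MeasurableAdd₂ M] {g : M → ℝ} (hg : Measurable g) (ν : Measure M)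
    [SFinite ν] : Measurable fun m => ∫ y, g (m + y) ∂ν := by
  have : Measurable fun p : M × M => g (p.1 + p.2) := hg.comp measurable_add
  exact this.stronglyMeasurable.integral_prod_right.measurable

noncomputable section

namespace BoundedMeasurable

section Basic

variable {M : Type*} [MeasurableSpace M]

instance : AddCommGroup (BoundedMeasurable M) :=
  inferInstanceAs (AddCommGroup (boundedMeasurable M))

instance : Module ℝ (BoundedMeasurable M) := inferInstanceAs (Module ℝ (boundedMeasurable M))

instance : FunLike (BoundedMeasurable M) M ℝ where
  coe g := g.1
  coe_injective := Subtype.val_injective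

@[ext]
theorem ext {f g : BoundedMeasurable M} (h : ∀ m, f m = g m) : f = g := DFunLike.ext _ _ h

theorem add_apply (f g : BoundedMeasurable M) (m : M) : (f + g) m = f m + g m := rfl

theorem smul_apply (c : ℝ) (g : BoundedMeasurable M) (m : M) : (c • g) m = c * g m := rfl

theorem measurable (g : BoundedMeasurable M) : Measurable g := g.2.1

theorem exists_bound (g : BoundedMeasurable M) : ∃ C, ∀ m, |g m| ≤ C := g.2.2

theorem integrable (g : BoundedMeasurable M) (μ : Measure M) [IsFiniteMeasure μ] :
    Integrable g μ := by
  obtain ⟨C, hC⟩ := g.exists_bound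
  exact g.measurable.integrable_of_abs_le hC

/-- A measurable function with values in `[0,1]`, as a bounded measurable function. -/
def ofIcc {g : M → ℝ} (hg : Measurable g) (h01 : ∀ m, g m ∈ Set.Icc (0 : ℝ) 1) :
    BoundedMeasurable M :=
  ⟨g, hg, 1, fun m => abs_le.2 ⟨by linarith [(h01 m).1], (h01 m).2⟩⟩

theorem integrable_mul (ν : Measure M) [IsFiniteMeasure ν] (f g : BoundedMeasurable M) :
    Integrable (fun y => f y * g y) ν := by
  obtain ⟨C, hC⟩ := f.exists_bound
  obtain ⟨D, hD⟩ := g.exists_bound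
  refine (f.measurable.mul g.measurable).integrable_of_abs_le (C := C * D) fun y => ?_
  rw [Pi.mul_apply, abs_mul]
  exact mul_le_mul (hC y) (hD y) (abs_nonneg _) ((abs_nonneg _).trans (hC y))

theorem integrable_sq (ν : Measure M) [IsFiniteMeasure ν] (g : BoundedMeasurable M) :
    Integrable (fun y => g y ^ 2) ν := by
  simpa only [sq] using integrable_mul ν g g

/-- The constant functions. -/
def const (c : ℝ) : BoundedMeasurable M := ⟨fun _ => c, measurable_const, |c|, fun _ => le_rfl⟩

theorem const_apply (c : ℝ) (m : M) : const c m = c := rfl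

end Basic

variable {M : Type*} [AddCommMonoid M] [MeasurableSpace M] [MeasurableAdd₂ M]
  (ν : Measure M) [IsFiniteMeasure ν]

theorem measurable_add_left (g : BoundedMeasurable M) (m : M) :
    Measurable fun y => g (m + y) := g.measurable.comp (measurable_const_add m)

theorem integrable_add_left (g : BoundedMeasurable M) (m : M) :
    Integrable (fun y => g (m + y)) ν := by
  obtain ⟨C, hC⟩ := g.exists_bound
  exact (g.measurable_add_left m).integrable_of_abs_le fun y => hC _

/-- The average of a function over one jump with intensity `ν`. -/
def jumpAverage : Module.End ℝ (BoundedMeasurable M) where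
  toFun g := ⟨fun m => ∫ y, g (m + y) ∂ν,
    Measurable.measurable_integral_add g.measurable ν, by
      obtain ⟨C, hC⟩ := g.exists_bound
      exact ⟨C * ν.real Set.univ, fun m => norm_integral_le_of_norm_le_const (μ := ν)
        (f := fun y => g (m + y)) (Filter.Eventually.of_forall fun y => hC (m + y))⟩⟩
  map_add' f g := by
    ext m
    exact integral_add (f.integrable_add_left ν m) (g.integrable_add_left ν m)
  map_smul' c g := by
    ext m
    exact integral_const_mul c _

theorem jumpAverage_apply (g : BoundedMeasurable M) (m : M) :
    jumpAverage ν g m = ∫ y, g (m + y) ∂ν := rfl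

/-- The transition operator of the Markov chain which makes a jump `y` with probability
`h ν(dy)` and stays where it is otherwise. -/
def jumpStep (h : ℝ) : Module.End ℝ (BoundedMeasurable M) :=
  (1 - h * ν.real Set.univ) • 1 + h • jumpAverage ν

theorem jumpStep_apply (h : ℝ) (g : BoundedMeasurable M) (m : M) :
    jumpStep ν h g m =
      (1 - h * ν.real Set.univ) * g m + h * ∫ y, g (m + y) ∂ν := rfl

theorem jumpStep_mono {h : ℝ} (h0 : 0 ≤ h) (h1 : h * ν.real Set.univ ≤ 1)
    {f g : BoundedMeasurable M} (hfg : ∀ m, f m ≤ g m) (m : M) :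
    jumpStep ν h f m ≤ jumpStep ν h g m := by
  rw [jumpStep_apply, jumpStep_apply]
  have := integral_mono (f.integrable_add_left ν m) (g.integrable_add_left ν m)
    fun y => hfg (m + y)
  have h2 := sub_nonneg.2 h1
  gcongr
  exact hfg m

theorem jumpStep_const (h c : ℝ) : jumpStep ν h (const c : BoundedMeasurable M) = const c := by
  ext m
  rw [jumpStep_apply]
  simp only [const_apply, integral_const, smul_eq_mul]
  ring

theorem jumpStep_mem_Icc {h : ℝ} (h0 : 0 ≤ h) (h1 : h * ν.real Set.univ ≤ 1) {a b : ℝ}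
    {g : BoundedMeasurable M} (hg : ∀ m, g m ∈ Set.Icc a b) (m : M) :
    jumpStep ν h g m ∈ Set.Icc a b := by
  have ha := jumpStep_mono ν h0 h1 (f := const a) (fun m => (hg m).1) m
  have hb := jumpStep_mono ν h0 h1 (g := const b) (fun m => (hg m).2) m
  rw [jumpStep_const] at ha hb
  exact ⟨ha, hb⟩

theorem jumpStep_pow_mem_Icc {h : ℝ} (h0 : 0 ≤ h) (h1 : h * ν.real Set.univ ≤ 1) {a b : ℝ}
    {g : BoundedMeasurable M} (hg : ∀ m, g m ∈ Set.Icc a b) (n : ℕ) (m : M) :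
    (jumpStep ν h ^ n) g m ∈ Set.Icc a b := by
  induction n generalizing m with
  | zero => exact hg m
  | succ n ih =>
    rw [pow_succ', Module.End.mul_apply]
    exact jumpStep_mem_Icc ν h0 h1 ih m

/-- The increment of `g` from `m` along a jump, as a function of the jump. -/
def increment (g : BoundedMeasurable M) (m : M) : BoundedMeasurable M :=
  ⟨fun y => g (m + y) - g m, (g.measurable_add_left m).sub_const _, by
    obtain ⟨C, hC⟩ := g.exists_bound
    exact ⟨C + C, fun y => (abs_sub _ _).trans (add_le_add (hC _) (hC _))⟩⟩

theorem increment_apply (g : BoundedMeasurable M) (m y : M) :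
    increment g m y = g (m + y) - g m := rfl

theorem measurable_integral_increment_sq (g : BoundedMeasurable M) :
    Measurable fun m => ∫ y, increment g m y ^ 2 ∂ν := by
  have : Measurable fun p : M × M => (g (p.1 + p.2) - g p.1) ^ 2 :=
    ((g.measurable.comp measurable_add).sub (g.measurable.comp measurable_fst)).pow_const 2
  exact this.stronglyMeasurable.integral_prod_right.measurable

/-- The interpolating functional `√(I(g)² + 2 t |Dg|²)`, where `|Dg|` is the norm of the increment
in `L²(ν)`. -/
def interpolant (t : ℝ) (g : BoundedMeasurable M) : BoundedMeasurable M :=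
  ⟨fun m => √(gaussianIsoperimetric (g m) ^ 2 +
      2 * t * ∫ y, increment g m y ^ 2 ∂ν),
    (((continuous_gaussianIsoperimetric.measurable.comp g.measurable).pow_const 2).add
      ((measurable_integral_increment_sq ν g).const_mul _)).sqrt, by
    obtain ⟨C, hC⟩ := g.exists_bound
    refine ⟨√(1 + |2 * t| * ((C + C) ^ 2 * ν.real Set.univ)), fun m => ?_⟩
    rw [abs_of_nonneg (Real.sqrt_nonneg _)]
    refine Real.sqrt_le_sqrt (add_le_add ?_ ?_)
    · exact pow_le_one₀ (gaussianIsoperimetric_nonneg _) (gaussianIsoperimetric_le_one _)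
    · refine (le_abs_self _).trans ?_
      rw [abs_mul]
      refine mul_le_mul_of_nonneg_left (norm_integral_le_of_norm_le_const (μ := ν)
        (f := fun y => increment g m y ^ 2) (Filter.Eventually.of_forall fun y => ?_))
        (abs_nonneg _)
      rw [norm_pow]
      exact pow_le_pow_left₀ (norm_nonneg _)
        ((abs_sub _ _).trans (add_le_add (hC _) (hC _))) 2⟩

theorem interpolant_apply (t : ℝ) (g : BoundedMeasurable M) (m : M) :
    interpolant ν t g m = √(gaussianIsoperimetric (g m) ^ 2 +
      2 * t * ∫ y, increment g m y ^ 2 ∂ν) := rfl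

theorem gaussianIsoperimetric_le_interpolant {t : ℝ} (ht : 0 ≤ t) (g : BoundedMeasurable M)
    (m : M) : gaussianIsoperimetric (g m) ≤ interpolant ν t g m := by
  have : 0 ≤ ∫ y, increment g m y ^ 2 ∂ν := integral_nonneg fun y => sq_nonneg _
  exact Real.le_sqrt_of_sq_le (le_add_of_nonneg_right (by positivity))

theorem interpolant_mono {t t' : ℝ} (htt : t ≤ t') (g : BoundedMeasurable M) (m : M) :
    interpolant ν t g m ≤ interpolant ν t' g m := by
  have : 0 ≤ ∫ y, increment g m y ^ 2 ∂ν := integral_nonneg fun y => sq_nonneg _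
  rw [interpolant_apply, interpolant_apply]
  gcongr

/-- The increment operator commutes with the jump dynamics. -/
theorem increment_jumpStep (h : ℝ) (g : BoundedMeasurable M) (m z : M) :
    increment (jumpStep ν h g) m z =
      (1 - h * ν.real Set.univ) * increment g m z +
        h * ∫ y, increment g (m + y) z ∂ν := by
  have h1 : ∫ y, increment g (m + y) z ∂ν =
      (∫ y, g (m + z + y) ∂ν) - ∫ y, g (m + y) ∂ν := by
    rw [← integral_sub (g.integrable_add_left ν _) (g.integrable_add_left ν m)]
    simp only [increment_apply, add_right_comm m _ z]
  rw [h1, increment_apply, jumpStep_apply, jumpStep_apply, increment_apply]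
  ring

theorem integrable_mul_increment (f g : BoundedMeasurable M) (m : M) :
    Integrable (Function.uncurry fun y z => f z * increment g (m + y) z) (ν.prod ν) := by
  obtain ⟨C, hC⟩ := f.exists_bound
  obtain ⟨D, hD⟩ := g.exists_bound
  refine Measurable.integrable_of_abs_le (C := C * (D + D)) ?_ fun p => ?_
  · have hm : Measurable fun p : M × M => m + p.1 := measurable_fst.const_add m
    exact (f.measurable.comp measurable_snd).mul
      ((g.measurable.comp (hm.add measurable_snd)).sub (g.measurable.comp hm))
  · simp only [Function.uncurry, increment_apply, abs_mul]
    exact mul_le_mul (hC _) ((abs_sub _ _).trans (add_le_add (hD _) (hD _))) (abs_nonneg _)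
      ((abs_nonneg _).trans (hC p.2))

theorem integral_increment_jumpStep_mul (h : ℝ) (f g : BoundedMeasurable M) (m : M) :
    ∫ z, f z * increment (jumpStep ν h g) m z ∂ν =
      (1 - h * ν.real Set.univ) * (∫ z, f z * increment g m z ∂ν) +
        h * ∫ y, ∫ z, f z * increment g (m + y) z ∂ν ∂ν := by
  have hint := integrable_mul_increment ν f g m
  rw [integral_integral_swap hint, ← integral_const_mul, ← integral_const_mul, ← integral_add]
  · congr 1
    funext z
    rw [increment_jumpStep, integral_const_mul]
    ring
  · exact (integrable_mul ν _ _).const_mul _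
  · exact hint.integral_prod_right.const_mul _

/-- One step of the dynamics increases the interpolating functional, up to an error of second
order: the jumps are absorbed by the Cauchy-Schwarz inequality, and what is left is
`gaussianIsoperimetric_jump_le`. -/
theorem interpolant_jumpStep_le {S : Set ℝ} (hS : S ⊆ Set.Ioo 0 1) {κ : ℝ} (hκ : 0 < κ)
    (hκS : ∀ a ∈ S, κ ≤ gaussianIsoperimetric a) {g : BoundedMeasurable M}
    (hg : ∀ m, g m ∈ S) {h t : ℝ} (h0 : 0 ≤ h) (h1 : h * ν.real Set.univ ≤ 1)
    (ht : 0 ≤ t) (hQ : ∀ m, jumpStep ν h g m ∈ S) (m : M) :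
    interpolant ν t (jumpStep ν h g) m ≤
      jumpStep ν h (interpolant ν (t + h) g) m +
        (ν.real Set.univ ^ 2 / κ + ν.real Set.univ ^ 2 / (2 * κ ^ 3)) * h ^ 2 := by
  set E := (ν.real Set.univ ^ 2 / κ + ν.real Set.univ ^ 2 / (2 * κ ^ 3)) * h ^ 2 with hE
  have hE0 : 0 ≤ E := by positivity
  have hjump := gaussianIsoperimetric_jump_le ν hS hκ hκS (hg m) (g.measurable_add_left m)
    (fun y => hg (m + y)) h0 h1 (hS (hQ m))
  rw [← hE, ← jumpStep_apply] at hjump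
  set q := gaussianIsoperimetric (jumpStep ν h g m) with hq
  have hqpos : 0 < q := gaussianIsoperimetric_pos (hS (hQ m))
  set J := interpolant ν t (jumpStep ν h g) m with hJ
  have hqJ : q ≤ J := gaussianIsoperimetric_le_interpolant ν ht _ m
  have hJpos : 0 < J := hqpos.trans_le hqJ
  set d := increment (jumpStep ν h g) m with hd
  have hJ2 : J ^ 2 = q ^ 2 + 2 * t * ∫ z, d z ^ 2 ∂ν := by
    have : 0 ≤ ∫ z, d z ^ 2 ∂ν := integral_nonneg fun z => sq_nonneg _
    exact Real.sq_sqrt (by positivity)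
  have hp := sub_nonneg.2 h1
  set p := 1 - h * ν.real Set.univ with hp'
  -- the state without a jump, where the increase of `t` is used
  set V := ∫ y, increment g m y ^ 2 ∂ν with hV
  have hV0 : 0 ≤ V := integral_nonneg fun y => sq_nonneg _
  set r := √(gaussianIsoperimetric (g m) ^ 2 + 2 * h * V) with hr
  have hg0 : 0 < gaussianIsoperimetric (g m) := gaussianIsoperimetric_pos (hS (hg m))
  have hrpos : 0 < r := Real.sqrt_pos.2 (by positivity)
  have hstay : q * r + 2 * t * ∫ z, d z * increment g m z ∂ν ≤
      J * interpolant ν (t + h) g m := by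
    have := add_integral_le_sqrt_mul_sqrt (integrable_sq ν d) (integrable_sq ν (increment g m))
      (integrable_mul ν d (increment g m)) hqpos hrpos ht
    rw [Real.sq_sqrt (by positivity)] at this
    refine this.trans_eq ?_
    rw [hJ, interpolant_apply, interpolant_apply]
    congr 2
    ring
  -- the states after a jump `y`
  have hmove : ∀ y, q * gaussianIsoperimetric (g (m + y)) +
      2 * t * ∫ z, d z * increment g (m + y) z ∂ν ≤
      J * interpolant ν (t + h) g (m + y) := fun y =>
    (add_integral_le_sqrt_mul_sqrt (integrable_sq ν d) (integrable_sq ν (increment g (m + y)))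
      (integrable_mul ν d _) hqpos (gaussianIsoperimetric_pos (hS (hg _))) ht).trans
      (mul_le_mul_of_nonneg_left (interpolant_mono ν (le_add_of_nonneg_right h0) g _) hJpos.le)
  have iI : Integrable (fun y => gaussianIsoperimetric (g (m + y))) ν :=
    (continuous_gaussianIsoperimetric.measurable.comp
      (g.measurable_add_left m)).integrable_of_abs_le (C := 1) fun y => by
        simp only [Function.comp]
        rw [abs_of_nonneg (gaussianIsoperimetric_nonneg _)]
        exact gaussianIsoperimetric_le_one _
  have iC : Integrable (fun y => ∫ z, d z * increment g (m + y) z ∂ν) ν :=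
    (integrable_mul_increment ν d g m).integral_prod_left
  have hmove' := integral_mono ((iI.const_mul q).add (iC.const_mul (2 * t)))
    (((interpolant ν (t + h) g).integrable_add_left ν m).const_mul J) hmove
  simp only [Pi.add_apply] at hmove'
  rw [integral_add (iI.const_mul q) (iC.const_mul (2 * t)), integral_const_mul,
    integral_const_mul, integral_const_mul] at hmove'
  have hcomm := integral_increment_jumpStep_mul ν h d g m
  simp only [← hd, ← sq, ← hp'] at hcomm
  rw [jumpStep_apply, ← hp']
  have e1 := mul_le_mul_of_nonneg_left hstay hp
  have e2 := mul_le_mul_of_nonneg_left hmove' h0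
  have e3 := mul_le_mul_of_nonneg_left hjump hqpos.le
  have e4 : q * E ≤ J * E := mul_le_mul_of_nonneg_right hqJ hE0
  simp only [← increment_apply, ← hV, ← hr] at e3
  refine le_of_mul_le_mul_left ?_ hJpos
  rw [← sq, hJ2, hcomm]
  linarith

/-- Over `n` steps the time parameter increases by `n h` and the errors add up. -/
theorem interpolant_jumpStep_pow_le {a b : ℝ} (hS : Set.Icc a b ⊆ Set.Ioo 0 1) {κ : ℝ} (hκ : 0 < κ)
    (hκS : ∀ x ∈ Set.Icc a b, κ ≤ gaussianIsoperimetric x) {g : BoundedMeasurable M}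
    (hg : ∀ m, g m ∈ Set.Icc a b) {h : ℝ} (h0 : 0 ≤ h) (h1 : h * ν.real Set.univ ≤ 1)
    (n : ℕ) {t : ℝ} (ht : 0 ≤ t) (m : M) :
    interpolant ν t ((jumpStep ν h ^ n) g) m ≤
      (jumpStep ν h ^ n) (interpolant ν (t + n * h) g) m +
        n * ((ν.real Set.univ ^ 2 / κ + ν.real Set.univ ^ 2 / (2 * κ ^ 3)) * h ^ 2) := by
  set E := (ν.real Set.univ ^ 2 / κ + ν.real Set.univ ^ 2 / (2 * κ ^ 3)) * h ^ 2 with hE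
  induction n generalizing t m with
  | zero => simp
  | succ n ih =>
    have hn := jumpStep_pow_mem_Icc ν h0 h1 hg n
    have e1 := interpolant_jumpStep_le ν hS hκ hκS hn h0 h1 ht (jumpStep_mem_Icc ν h0 h1 hn) m
    have e2 := jumpStep_mono ν h0 h1
      (g := (jumpStep ν h ^ n) (interpolant ν (t + h + n * h) g) + const (n * E))
      (fun m => ih (add_nonneg ht h0) m) m
    rw [map_add, jumpStep_const] at e2
    rw [pow_succ', Module.End.mul_apply, Module.End.mul_apply]
    have e3 : t + ((n + 1 : ℕ) : ℝ) * h = t + h + n * h := by push_cast; ring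
    have e4 : ((n + 1 : ℕ) : ℝ) * E = n * E + E := by push_cast; ring
    rw [e3, e4]
    calc _ ≤ _ := e1
      _ ≤ _ := add_le_add e2 le_rfl
      _ = _ := by
        rw [add_apply, add_assoc]
        rfl

end BoundedMeasurable

end

/-! ### Compound Poisson laws -/

noncomputable section

section CompoundPoisson

variable {M : Type*} [AddCommMonoid M] [MeasurableSpace M] (ν : Measure M)

/-- The `n`-fold convolution power of `ν`. -/
def convPow : ℕ → Measure M
  | 0 => Measure.dirac 0
  | n + 1 => (ν.prod (convPow n)).map fun p => p.1 + p.2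

/-- The compound Poisson law with jump measure `ν`, i.e. the convolution exponential of
`ν - ν(M) δ_0`. -/
def compoundPoisson : Measure M :=
  Measure.sum fun n : ℕ =>
    ENNReal.ofReal (Real.exp (-ν.real Set.univ) / (n.factorial : ℝ)) • convPow ν n

theorem hasSum_integral_compoundPoisson {E : Type*} [NormedAddCommGroup E] [NormedSpace ℝ E]
    {f : M → E} (hf : Integrable f (compoundPoisson ν)) :
    HasSum (fun n : ℕ => (Real.exp (-ν.real Set.univ) / (n.factorial : ℝ)) • ∫ m, f m ∂convPow ν n)
      (∫ m, f m ∂compoundPoisson ν) := by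
  have := hasSum_integral_measure hf
  refine this.congr_fun fun n => ?_
  rw [integral_smul_measure, ENNReal.toReal_ofReal (by positivity)]

variable [MeasurableAdd₂ M]

theorem integral_convPow_succ {E : Type*} [NormedAddCommGroup E] [NormedSpace ℝ E] (n : ℕ)
    {f : M → E} (hf : StronglyMeasurable f) :
    ∫ m, f m ∂convPow ν (n + 1) = ∫ p, f (p.1 + p.2) ∂ν.prod (convPow ν n) := by
  rw [convPow, integral_map measurable_add.aemeasurable hf.aestronglyMeasurable]

variable [IsFiniteMeasure ν]

instance isFiniteMeasure_convPow (n : ℕ) : IsFiniteMeasure (convPow ν n) := by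
  induction n with
  | zero => exact inferInstanceAs (IsFiniteMeasure (Measure.dirac 0))
  | succ n ih => exact inferInstanceAs (IsFiniteMeasure ((ν.prod (convPow ν n)).map _))

theorem convPow_univ (n : ℕ) : convPow ν n Set.univ = ν Set.univ ^ n := by
  induction n with
  | zero => simp [convPow]
  | succ n ih =>
    rw [convPow, Measure.map_apply measurable_add MeasurableSet.univ, Set.preimage_univ,
      ← Set.univ_prod_univ, Measure.prod_prod, ih, pow_succ']

theorem jumpAverage_pow_apply_zero (n : ℕ) (g : BoundedMeasurable M) :
    (BoundedMeasurable.jumpAverage ν ^ n) g 0 = ∫ m, g m ∂convPow ν n := by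
  induction n generalizing g with
  | zero =>
    rw [convPow, integral_dirac' _ _ g.measurable.stronglyMeasurable]
    rfl
  | succ n ih =>
    rw [pow_succ, Module.End.mul_apply, ih,
      integral_convPow_succ _ _ g.measurable.stronglyMeasurable, integral_prod_symm]
    · simp only [BoundedMeasurable.jumpAverage_apply, add_comm]
    · obtain ⟨C, hC⟩ := g.exists_bound
      exact (g.measurable.comp measurable_add).integrable_of_abs_le fun p => hC _

theorem integral_convPow_of_map_add {χ : M → ℂ} (hχ : StronglyMeasurable χ) (h0 : χ 0 = 1)
    (hadd : ∀ a b, χ (a + b) = χ a * χ b) (n : ℕ) :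
    ∫ m, χ m ∂convPow ν n = (∫ m, χ m ∂ν) ^ n := by
  induction n with
  | zero => rw [convPow, integral_dirac' _ _ hχ, h0, pow_zero]
  | succ n ih =>
    rw [integral_convPow_succ _ _ hχ]
    simp only [hadd]
    rw [integral_prod_mul, ih, pow_succ']

theorem hasSum_exp_neg_div_factorial (s : ℝ) :
    HasSum (fun n : ℕ => Real.exp (-s) / (n.factorial : ℝ) * s ^ n) 1 := by
  have := (NormedSpace.expSeries_div_hasSum_exp s).mul_left (Real.exp (-s))
  rw [← Real.exp_eq_exp_ℝ, ← Real.exp_add, neg_add_cancel, Real.exp_zero] at this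
  refine this.congr_fun fun n => ?_
  ring

instance isProbabilityMeasure_compoundPoisson : IsProbabilityMeasure (compoundPoisson ν) := by
  constructor
  rw [compoundPoisson, Measure.sum_apply _ MeasurableSet.univ]
  have : ∀ n : ℕ, (ENNReal.ofReal (Real.exp (-ν.real Set.univ) / (n.factorial : ℝ)) •
      convPow ν n) Set.univ = ENNReal.ofReal
        (Real.exp (-ν.real Set.univ) / (n.factorial : ℝ) * ν.real Set.univ ^ n) := fun n => by
    rw [Measure.smul_apply, convPow_univ, smul_eq_mul, ENNReal.ofReal_mul (by positivity),
      ENNReal.ofReal_pow measureReal_nonneg, ofReal_measureReal]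
  simp only [this]
  have hs := hasSum_exp_neg_div_factorial (ν.real Set.univ)
  rw [← ENNReal.ofReal_tsum_of_nonneg (fun n => by positivity) hs.summable, hs.tsum_eq,
    ENNReal.ofReal_one]

/-- The Lévy-Khintchine formula for a compound Poisson law; `χ` is a bounded character of `M`. -/
theorem integral_compoundPoisson_of_map_add {χ : M → ℂ} (hχ : StronglyMeasurable χ)
    (hb : ∀ m, ‖χ m‖ ≤ 1) (h0 : χ 0 = 1) (hadd : ∀ a b, χ (a + b) = χ a * χ b) :
    ∫ m, χ m ∂compoundPoisson ν = Complex.exp ((∫ m, χ m ∂ν) - ν.real Set.univ) := by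
  have hi : Integrable χ (compoundPoisson ν) :=
    Integrable.of_bound hχ.aestronglyMeasurable 1 (Filter.Eventually.of_forall hb)
  refine (hasSum_integral_compoundPoisson ν hi).unique ?_
  have := (NormedSpace.expSeries_div_hasSum_exp (∫ m, χ m ∂ν)).mul_left
    (Complex.exp (-(ν.real Set.univ : ℂ)))
  rw [← Complex.exp_eq_exp_ℂ, ← Complex.exp_add, neg_add_eq_sub] at this
  refine this.congr_fun fun n => ?_
  rw [integral_convPow_of_map_add ν hχ h0 hadd, Complex.real_smul]
  push_cast
  ring

namespace BoundedMeasurable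

theorem jumpStep_pow_apply_zero (h : ℝ) (n : ℕ) (g : BoundedMeasurable M) :
    (jumpStep ν h ^ n) g 0 = ∑ k ∈ Finset.range (n + 1),
      (n.choose k : ℝ) * h ^ k * (1 - h * ν.real Set.univ) ^ (n - k) *
        ∫ m, g m ∂convPow ν k := by
  -- expand the power of `h A + (1 - h ν(M))` by the binomial formula
  have hc : Commute (h • jumpAverage ν)
      ((1 - h * ν.real Set.univ) • (1 : Module.End ℝ (BoundedMeasurable M))) :=
    (Commute.one_right _).smul_right _
  have hev : ∀ (t : Finset ℕ) (f : ℕ → BoundedMeasurable M),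
      (∑ k ∈ t, f k) 0 = ∑ k ∈ t, f k 0 := fun t f =>
    map_sum (⟨⟨fun g => g 0, fun _ _ => rfl⟩, fun _ _ => rfl⟩ : BoundedMeasurable M →ₗ[ℝ] ℝ) f t
  rw [jumpStep, add_comm, hc.add_pow, LinearMap.sum_apply, hev]
  refine Finset.sum_congr rfl fun k _ => ?_
  rw [smul_pow, smul_pow, one_pow, ← jumpAverage_pow_apply_zero, ← Nat.smul_one_eq_cast,
    mul_smul_comm, mul_smul_comm, smul_mul_assoc, mul_one, mul_one, ← Nat.cast_smul_eq_nsmul ℝ]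
  simp only [LinearMap.smul_apply, smul_apply]
  ring

/-- The law of rare events: the jump chain with steps of size `1 / n` converges after `n` steps to
the compound Poisson law. -/
theorem tendsto_jumpStep_pow (g : BoundedMeasurable M) :
    Filter.Tendsto (fun n : ℕ => (jumpStep ν (n : ℝ)⁻¹ ^ n) g 0) Filter.atTop
      (𝓝 (∫ m, g m ∂compoundPoisson ν)) := by
  set s := ν.real Set.univ with hs
  have hs0 : 0 ≤ s := measureReal_nonneg
  obtain ⟨C, hC⟩ := g.exists_bound
  have hC0 : 0 ≤ C := (abs_nonneg _).trans (hC 0)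
  have ha : ∀ k, |∫ m, g m ∂convPow ν k| ≤ C * s ^ k := fun k => by
    have := norm_integral_le_of_norm_le_const (μ := convPow ν k) (f := g)
      (Filter.Eventually.of_forall hC)
    rwa [measureReal_def, convPow_univ, ENNReal.toReal_pow] at this
  -- when `s = 0` the division is harmless, since then only `k = 0` contributes
  have ha' : ∀ k, s ^ k * ((∫ m, g m ∂convPow ν k) / s ^ k) = ∫ m, g m ∂convPow ν k := fun k => by
    refine mul_div_cancel_of_imp' fun h => ?_
    have := ha k
    rwa [h, mul_zero, abs_nonpos_iff] at this
  have hsum := (hasSum_integral_compoundPoisson ν (g.integrable _)).tsum_eq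
  rw [← hsum]
  have heq : ∀ n : ℕ, (jumpStep ν (n : ℝ)⁻¹ ^ n) g 0 = ∑' k, (n.choose k : ℝ) * (n : ℝ)⁻¹ ^ k *
      (1 - (n : ℝ)⁻¹ * s) ^ (n - k) * ∫ m, g m ∂convPow ν k := fun n => by
    rw [jumpStep_pow_apply_zero, tsum_eq_sum]
    intro k hk
    rw [Finset.mem_range, not_lt] at hk
    rw [Nat.choose_eq_zero_of_lt hk, Nat.cast_zero, zero_mul, zero_mul, zero_mul]
  simp only [heq]
  refine tendsto_tsum_of_dominated_convergence (bound := fun k => C * (s ^ k / k.factorial))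
    ?_ ?_ ?_
  · exact (Real.summable_pow_div_factorial s).mul_left C
  · intro k
    have hp : Filter.Tendsto (fun n : ℕ => (n : ℝ) * ((n : ℝ)⁻¹ * s)) Filter.atTop (𝓝 s) := by
      refine tendsto_const_nhds.congr' ?_
      filter_upwards [Filter.eventually_ne_atTop 0] with n hn
      field_simp
    have := (tendsto_choose_mul_pow_of_tendsto_mul_atTop k hp).mul_const
      ((∫ m, g m ∂convPow ν k) / s ^ k)
    have e : Real.exp (-s) * s ^ k / k.factorial * ((∫ m, g m ∂convPow ν k) / s ^ k) =
        (Real.exp (-s) / k.factorial) • ∫ m, g m ∂convPow ν k := by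
      conv_rhs => rw [← ha' k]
      rw [smul_eq_mul]
      ring
    rw [e] at this
    refine this.congr fun n => ?_
    conv_rhs => rw [← ha' k]
    ring
  · filter_upwards [Filter.eventually_ge_atTop (max 1 ⌈s⌉₊)] with n hn k
    have hn1 : 1 ≤ n := (le_max_left _ _).trans hn
    have hns : s ≤ n := (Nat.le_ceil s).trans (by exact_mod_cast (le_max_right _ _).trans hn)
    have hn0 : (0 : ℝ) < n := by exact_mod_cast hn1
    have h1 : 0 ≤ 1 - (n : ℝ)⁻¹ * s := by
      rw [sub_nonneg, inv_mul_le_iff₀ hn0, mul_one]; exact hns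
    have h2 : 1 - (n : ℝ)⁻¹ * s ≤ 1 := by
      have : 0 ≤ (n : ℝ)⁻¹ * s := by positivity
      linarith
    have h3 : (n.choose k : ℝ) * (n : ℝ)⁻¹ ^ k ≤ 1 / k.factorial := by
      calc (n.choose k : ℝ) * (n : ℝ)⁻¹ ^ k ≤ (n : ℝ) ^ k / k.factorial * (n : ℝ)⁻¹ ^ k := by
            gcongr
            exact Nat.choose_le_pow_div k n
        _ = 1 / k.factorial := by
            rw [inv_pow]
            field_simp
    rw [norm_mul, Real.norm_of_nonneg (by positivity), Real.norm_eq_abs]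
    calc _ ≤ 1 / (k.factorial : ℝ) * 1 * (C * s ^ k) := by
          gcongr
          · exact pow_le_one₀ h1 h2
          · exact ha k
      _ = _ := by ring

/-- The isoperimetric inequality for functions with values away from the end points. -/
theorem gaussianIsoperimetric_integral_le_of_mem_Icc {a b : ℝ} (hS : Set.Icc a b ⊆ Set.Ioo 0 1)
    {g : BoundedMeasurable M} (hg : ∀ m, g m ∈ Set.Icc a b) :
    gaussianIsoperimetric (∫ m, g m ∂compoundPoisson ν) ≤
      ∫ m, interpolant ν 1 g m ∂compoundPoisson ν := by
  obtain ⟨x, hx, hmin⟩ := isCompact_Icc.exists_isMinOn ⟨g 0, hg 0⟩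
    continuous_gaussianIsoperimetric.continuousOn
  set κ := gaussianIsoperimetric x with hκ
  have hκ0 : 0 < κ := gaussianIsoperimetric_pos (hS hx)
  set s := ν.real Set.univ with hs
  have hl : Filter.Tendsto (fun n : ℕ => gaussianIsoperimetric ((jumpStep ν (n : ℝ)⁻¹ ^ n) g 0))
      Filter.atTop (𝓝 (gaussianIsoperimetric (∫ m, g m ∂compoundPoisson ν))) :=
    (continuous_gaussianIsoperimetric.tendsto _).comp (tendsto_jumpStep_pow ν g)
  have hr : Filter.Tendsto (fun n : ℕ => (jumpStep ν (n : ℝ)⁻¹ ^ n) (interpolant ν 1 g) 0 +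
      (s ^ 2 / κ + s ^ 2 / (2 * κ ^ 3)) * (n : ℝ)⁻¹)
      Filter.atTop (𝓝 (∫ m, interpolant ν 1 g m ∂compoundPoisson ν)) := by
    have := (tendsto_jumpStep_pow ν (interpolant ν 1 g)).add
      ((tendsto_inv_atTop_nhds_zero_nat (𝕜 := ℝ)).const_mul (s ^ 2 / κ + s ^ 2 / (2 * κ ^ 3)))
    rwa [mul_zero, add_zero] at this
  refine le_of_tendsto_of_tendsto hl hr ?_
  filter_upwards [Filter.eventually_ge_atTop (max 1 ⌈s⌉₊)] with n hn
  have hn1 : 1 ≤ n := (le_max_left _ _).trans hn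
  have hns : s ≤ n := (Nat.le_ceil s).trans (by exact_mod_cast (le_max_right _ _).trans hn)
  have hn0 : (0 : ℝ) < n := by exact_mod_cast hn1
  have h1 : (n : ℝ)⁻¹ * s ≤ 1 := by rw [inv_mul_le_iff₀ hn0, mul_one]; exact hns
  have key := interpolant_jumpStep_pow_le ν hS hκ0 (fun y hy => hmin hy) hg
    (inv_nonneg.2 hn0.le) h1 n le_rfl 0
  rw [zero_add, mul_inv_cancel₀ hn0.ne'] at key
  refine ((gaussianIsoperimetric_le_interpolant ν le_rfl _ 0).trans key).trans_eq ?_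
  rw [← hs, mul_left_comm, sq (n : ℝ)⁻¹, mul_inv_cancel_left₀ hn0.ne']

end BoundedMeasurable

/-- The isoperimetric inequality for compound Poisson laws. -/
theorem gaussianIsoperimetric_integral_compoundPoisson_le {g : M → ℝ} (hg : Measurable g)
    (h01 : ∀ m, g m ∈ Set.Icc (0 : ℝ) 1) :
    gaussianIsoperimetric (∫ m, g m ∂compoundPoisson ν) ≤
      ∫ m, √(gaussianIsoperimetric (g m) ^ 2 + 2 * ∫ y, (g (m + y) - g m) ^ 2 ∂ν)
        ∂compoundPoisson ν := by
  set G := BoundedMeasurable.ofIcc hg h01 with hG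
  set ε : ℕ → ℝ := fun n => ((n : ℝ) + 3)⁻¹ with hε
  have hε0 : ∀ n, 0 < ε n := fun n => by positivity
  have hε1 : ∀ n, ε n ≤ 3⁻¹ := fun n => by
    have : (0 : ℝ) ≤ n := n.cast_nonneg
    exact inv_anti₀ (by norm_num) (by linarith)
  have hεlim : Filter.Tendsto ε Filter.atTop (𝓝 0) :=
    tendsto_inv_atTop_zero.comp (Filter.tendsto_atTop_add_const_right _ _
      tendsto_natCast_atTop_atTop)
  -- shrink the range of `g` to `[ε, 1 - ε]`
  set Gε : ℕ → BoundedMeasurable M := fun n => .const (ε n) + (1 - 2 * ε n) • G with hGε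
  have hGεm : ∀ n m, Gε n m = ε n + (1 - 2 * ε n) * g m := fun n m => rfl
  have hlimε : ∀ x : ℝ, Filter.Tendsto (fun n => ε n + (1 - 2 * ε n) * x) Filter.atTop (𝓝 x) := by
    intro x
    have := hεlim.add (((hεlim.const_mul 2).const_sub 1).mul_const x)
    simpa using this
  have hmem : ∀ n m, Gε n m ∈ Set.Icc (ε n) (1 - ε n) := fun n m => by
    rw [hGεm]
    have h1 := hε0 n
    have h2 := hε1 n
    obtain ⟨h3, h4⟩ := h01 m
    have h5 : 0 ≤ (1 - 2 * ε n) := by linarith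
    exact ⟨by nlinarith, by nlinarith⟩
  have key : ∀ n, gaussianIsoperimetric (∫ m, Gε n m ∂compoundPoisson ν) ≤
      ∫ m, BoundedMeasurable.interpolant ν 1 (Gε n) m ∂compoundPoisson ν := fun n =>
    BoundedMeasurable.gaussianIsoperimetric_integral_le_of_mem_Icc ν
      (fun x hx => ⟨(hε0 n).trans_le hx.1, by linarith [hx.2, hε0 n]⟩) (hmem n)
  have hintG : Integrable g (compoundPoisson ν) := G.integrable _
  have hint : ∀ n, ∫ m, Gε n m ∂compoundPoisson ν =
      ε n + (1 - 2 * ε n) * ∫ m, g m ∂compoundPoisson ν := fun n => by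
    simp only [hGεm]
    rw [integral_add (integrable_const _) (hintG.const_mul _), integral_const_mul,
      integral_const, probReal_univ, one_smul]
  have hincr : ∀ n m, ∫ y, BoundedMeasurable.increment (Gε n) m y ^ 2 ∂ν =
      (1 - 2 * ε n) ^ 2 * ∫ y, (g (m + y) - g m) ^ 2 ∂ν := fun n m => by
    rw [← integral_const_mul]
    congr 1
    funext y
    rw [BoundedMeasurable.increment_apply, hGεm, hGεm]
    ring
  have hincr1 : ∀ m, ∫ y, (g (m + y) - g m) ^ 2 ∂ν ≤ ν.real Set.univ := fun m => by
    have hle : ∀ y, (g (m + y) - g m) ^ 2 ≤ 1 := fun y => by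
      rw [sq_le_one_iff_abs_le_one, abs_le]
      exact ⟨by linarith [(h01 (m + y)).1, (h01 m).2], by linarith [(h01 (m + y)).2, (h01 m).1]⟩
    have : ∫ y, (g (m + y) - g m) ^ 2 ∂ν ≤ ∫ _, 1 ∂ν :=
      integral_mono (BoundedMeasurable.integrable_sq ν (.increment G m)) (integrable_const 1) hle
    simpa using this
  have hl : Filter.Tendsto (fun n => gaussianIsoperimetric (∫ m, Gε n m ∂compoundPoisson ν))
      Filter.atTop (𝓝 (gaussianIsoperimetric (∫ m, g m ∂compoundPoisson ν))) := by
    simp only [hint]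
    exact (continuous_gaussianIsoperimetric.tendsto _).comp (hlimε _)
  refine le_of_tendsto_of_tendsto' hl ?_ key
  refine tendsto_integral_of_dominated_convergence (fun _ => √(1 + 2 * ν.real Set.univ))
    (fun n => (BoundedMeasurable.measurable _).aestronglyMeasurable) (integrable_const _)
    (fun n => Filter.Eventually.of_forall fun m => ?_) (Filter.Eventually.of_forall fun m => ?_)
  · rw [BoundedMeasurable.interpolant_apply, hincr, Real.norm_of_nonneg (Real.sqrt_nonneg _),
      mul_one]
    have h1 : gaussianIsoperimetric (Gε n m) ^ 2 ≤ 1 :=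
      pow_le_one₀ (gaussianIsoperimetric_nonneg _) (gaussianIsoperimetric_le_one _)
    have h2 : (1 - 2 * ε n) ^ 2 ≤ 1 :=
      pow_le_one₀ (by linarith [hε1 n]) (by linarith [hε0 n])
    have h3 : 0 ≤ ∫ y, (g (m + y) - g m) ^ 2 ∂ν := integral_nonneg fun y => sq_nonneg _
    refine Real.sqrt_le_sqrt ?_
    nlinarith [hincr1 m]
  · simp only [BoundedMeasurable.interpolant_apply, hincr, hGεm, mul_one]
    have h1 : Filter.Tendsto (fun n => (1 - 2 * ε n) ^ 2 * ∫ y, (g (m + y) - g m) ^ 2 ∂ν)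
        Filter.atTop (𝓝 (∫ y, (g (m + y) - g m) ^ 2 ∂ν)) := by
      have := (((hεlim.const_mul 2).const_sub 1).pow 2).mul_const (∫ y, (g (m + y) - g m) ^ 2 ∂ν)
      simpa using this
    have h2 : Filter.Tendsto (fun n => gaussianIsoperimetric (ε n + (1 - 2 * ε n) * g m))
        Filter.atTop (𝓝 (gaussianIsoperimetric (g m))) :=
      (continuous_gaussianIsoperimetric.tendsto _).comp (hlimε _)
    exact ((h2.pow 2).add (h1.const_mul 2)).sqrt

end CompoundPoisson

end

/-! ### Poisson measures as compound Poisson laws -/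

noncomputable section

theorem integral_comp_of_fintype {X κ E : Type*} [MeasurableSpace X] [Fintype κ]
    [MeasurableSpace κ] [MeasurableSingletonClass κ] [NormedAddCommGroup E] [NormedSpace ℝ E]
    [CompleteSpace E] (μ : Measure X) [IsFiniteMeasure μ] {b : X → κ} (hb : Measurable b)
    (f : κ → E) : ∫ x, f (b x) ∂μ = ∑ T, μ.real (b ⁻¹' {T}) • f T := by
  rw [← integral_map hb.aemeasurable StronglyMeasurable.of_discrete.aestronglyMeasurable,
    integral_fintype .of_finite]
  refine Finset.sum_congr rfl fun T _ => ?_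
  rw [map_measureReal_apply hb (measurableSet_singleton T)]

theorem integral_exp_poissonMeasure (r : NNReal) (t : ℝ) :
    ∫ k : ℕ, Complex.exp ((t * k : ℝ) * Complex.I) ∂poissonMeasure r =
      Complex.exp (r * (Complex.exp (t * Complex.I) - 1)) := by
  rw [← charFun_map_cast_poissonMeasure, charFun_apply, integral_map .of_discrete (by fun_prop)]
  rfl

namespace Configuration

/-- Real valued functions of a measurable set, with the product σ-algebra. -/
abbrev CountSpace (X : Type*) [MeasurableSpace X] : Type _ := {B : Set X // MeasurableSet B} → ℝ

/-- The increase of the counts when a point `x` is added. -/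
def pointCounts {X : Type*} [MeasurableSpace X] (x : X) : CountSpace X :=
  fun B => B.1.indicator (fun _ => 1) x

theorem measurable_pointCounts {X : Type*} [MeasurableSpace X] :
    Measurable (pointCounts (X := X)) :=
  measurable_pi_lambda _ fun B => measurable_const.indicator B.2

variable {X : Type*} [TopologicalSpace X] [MeasurableSpace X]

/-- The numbers of points of a configuration in the measurable sets. An infinite number of points
is counted as `0`; almost no configuration is concerned. -/
def counts (ω : Configuration X) : CountSpace X := fun B => ω.toMeasure.real B

theorem measurable_toMeasure_apply {B : Set X} (hB : MeasurableSet B) :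
    Measurable fun ω : Configuration X => ω.toMeasure B := by
  rw [measurable_iff_comap_le]
  exact le_iSup₂_of_le B hB le_rfl

theorem measurable_counts : Measurable (counts (X := X)) :=
  measurable_pi_lambda _ fun B => (measurable_toMeasure_apply B.2).ennreal_toReal

theorem measurableSpace_eq_comap :
    (inferInstance : MeasurableSpace (Configuration X)) =
      MeasurableSpace.pi.comap
        fun (ω : Configuration X) (B : {B : Set X // MeasurableSet B}) => ω.toMeasure B := by
  rw [MeasurableSpace.pi, MeasurableSpace.comap_iSup, iSup_subtype]
  simp only [MeasurableSpace.comap_comp]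
  rfl

theorem measureReal_toMeasure {ω : Configuration X} (hω : ω.points.Finite) {B : Set X}
    (hB : MeasurableSet B) : ω.toMeasure.real B = ((ω.points ∩ B).ncard : ℝ) := by
  rw [measureReal_def, toMeasure_apply ω hB, ← (hω.inter_of_left B).cast_ncard_eq]
  simp

theorem toMeasure_apply_of_finite {ω : Configuration X} (hω : ω.points.Finite) {B : Set X}
    (hB : MeasurableSet B) : ω.toMeasure B = ((ω.points ∩ B).ncard : ENNReal) := by
  rw [toMeasure_apply ω hB, ← (hω.inter_of_left B).cast_ncard_eq]
  simp

theorem isFiniteMeasure_toMeasure {ω : Configuration X} (hω : ω.points.Finite) :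
    IsFiniteMeasure ω.toMeasure :=
  ⟨by rw [toMeasure_apply_of_finite hω MeasurableSet.univ]; exact ENNReal.natCast_lt_top _⟩

theorem counts_addPoint {ω : Configuration X} (hω : ω.points.Finite) {x : X} (hx : x ∉ ω.points) :
    counts (ω.addPoint x) = counts ω + pointCounts x := by
  have hω' : (ω.addPoint x).points.Finite := hω.insert x
  funext B
  rw [Pi.add_apply, counts, counts, pointCounts, measureReal_toMeasure hω B.2,
    measureReal_toMeasure hω' B.2]
  by_cases hxB : x ∈ B.1
  · rw [Set.indicator_of_mem hxB, addPoint, Set.insert_inter_of_mem hxB,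
      Set.ncard_insert_of_notMem (fun h => hx h.1) (hω.inter_of_left _)]
    push_cast
    rfl
  · rw [Set.indicator_of_notMem hxB, addPoint, Set.insert_inter_of_notMem hxB, add_zero]

/-- A measurable function on configurations is, on finite configurations, a measurable function
of the counts. -/
theorem exists_measurable_comp_counts {F : Configuration X → ℝ} (hF : Measurable F) :
    ∃ G : CountSpace X → ℝ, Measurable G ∧
      ∀ ω : Configuration X, ω.points.Finite → F ω = G (counts ω) := by
  obtain ⟨G, hG, hFG⟩ :=
    (hF.mono (measurableSpace_eq_comap (X := X)).le le_rfl).exists_eq_measurable_comp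
  refine ⟨fun c => G fun B => ENNReal.ofReal (c B),
    hG.comp (measurable_pi_lambda _ fun B => (measurable_pi_apply B).ennreal_ofReal),
    fun ω hω => ?_⟩
  have := isFiniteMeasure_toMeasure hω
  simp only [hFG, Function.comp, counts, fun B => ofReal_measureReal (measure_ne_top ω.toMeasure B)]

namespace IsPoissonMeasure

variable {σ : Measure X} {π : Measure (Configuration X)}

theorem isProbabilityMeasure (hπ : IsPoissonMeasure σ π) : IsProbabilityMeasure π := by
  constructor
  have := hπ 0 (fun i => i.elim0) (fun i => i.elim0) (fun i => i.elim0) (fun i => i.elim0)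
  simpa using this

theorem measure_counts_eq [IsFiniteMeasure σ] (hπ : IsPoissonMeasure σ π) {ι : Type*}
    [Fintype ι] {A : ι → Set X}
    (hA : ∀ i, MeasurableSet (A i)) (hd : Pairwise fun i j => Disjoint (A i) (A j)) (k : ι → ℕ) :
    π {ω | ∀ i, ω.toMeasure (A i) = (k i : ENNReal)} =
      Measure.pi (fun i => poissonMeasure (σ (A i)).toNNReal) {k} := by
  let e := Fintype.equivFin ι
  have := hπ (Fintype.card ι) (fun i => A (e.symm i)) (fun i => hA _)
    (fun i j hij => hd (e.symm.injective.ne hij)) (fun i => k (e.symm i))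
  rw [Measure.pi_singleton]
  have h1 : {ω : Configuration X | ∀ i, ω.toMeasure (A (e.symm i)) = (k (e.symm i) : ENNReal)} =
      {ω | ∀ i, ω.toMeasure (A i) = (k i : ENNReal)} := by
    ext ω
    exact e.symm.forall_congr_right (q := fun i => ω.toMeasure (A i) = (k i : ENNReal))
  rw [h1, e.symm.prod_comp (fun i => σ.real (A i) ^ k i / (Nat.factorial (k i) : ℝ) *
    Real.exp (-σ.real (A i)))] at this
  rw [this, ENNReal.ofReal_prod_of_nonneg fun i _ => by positivity]
  refine Finset.prod_congr rfl fun i _ => ?_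
  rw [poissonMeasure_singleton]
  congr 1
  change _ = Real.exp (-σ.real (A i)) * σ.real (A i) ^ k i / _
  ring

theorem ae_finite [IsFiniteMeasure σ] (hπ : IsPoissonMeasure σ π) : ∀ᵐ ω ∂π, ω.points.Finite := by
  have := hπ.isProbabilityMeasure
  have hmeas : ∀ k : ℕ,
      MeasurableSet {ω : Configuration X | ω.toMeasure Set.univ = (k : ENNReal)} := fun k =>
    measurable_toMeasure_apply MeasurableSet.univ (measurableSet_singleton _)
  have h1 : ∀ k : ℕ, π {ω | ω.toMeasure Set.univ = (k : ENNReal)} =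
      poissonMeasure (σ Set.univ).toNNReal {k} := fun k => by
    have := hπ.measure_counts_eq (ι := Unit) (A := fun _ => Set.univ) (fun _ => MeasurableSet.univ)
      (fun i j hij => (hij (Subsingleton.elim i j)).elim) (fun _ => k)
    rw [Measure.pi_singleton] at this
    simpa using this
  have h2 : π (⋃ k : ℕ, {ω | ω.toMeasure Set.univ = (k : ENNReal)}) = 1 := by
    rw [measure_iUnion _ hmeas]
    · simp only [h1]
      rw [← measure_univ (μ := poissonMeasure (σ Set.univ).toNNReal), ← Set.iUnion_of_singleton ℕ,
        measure_iUnion _ fun k => measurableSet_singleton k]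
      exact fun i j hij => Set.disjoint_singleton.2 hij
    · intro i j hij
      refine Set.disjoint_left.2 fun ω hi hj => hij ?_
      exact_mod_cast (hi : ω.toMeasure Set.univ = i).symm.trans hj
  have h3 : ∀ᵐ ω ∂π, ω ∈ ⋃ k : ℕ, {ω : Configuration X | ω.toMeasure Set.univ = (k : ENNReal)} :=
    (mem_ae_iff_prob_eq_one (MeasurableSet.iUnion hmeas)).2 h2
  filter_upwards [h3] with ω hω
  obtain ⟨k, hk⟩ := Set.mem_iUnion.1 hω
  rw [Set.mem_ofPred_eq, toMeasure_apply ω MeasurableSet.univ, Set.inter_univ] at hk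
  refine Set.encard_ne_top_iff.1 fun h => ?_
  rw [h] at hk
  simp at hk

/-- The characteristic function of the counts of disjoint sets. -/
theorem integral_exp_counts [IsFiniteMeasure σ] (hπ : IsPoissonMeasure σ π) {ι : Type*}
    [Fintype ι] {A : ι → Set X}
    (hA : ∀ i, MeasurableSet (A i)) (hd : Pairwise fun i j => Disjoint (A i) (A j)) (v : ι → ℝ) :
    ∫ ω, Complex.exp ((∑ i, v i * ω.toMeasure.real (A i) : ℝ) * Complex.I) ∂π =
      Complex.exp (∑ i, σ.real (A i) * (Complex.exp (v i * Complex.I) - 1)) := by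
  have := hπ.isProbabilityMeasure
  let N : Configuration X → ι → ℕ := fun ω i => ⌊ω.toMeasure.real (A i)⌋₊
  have hN : Measurable N := measurable_pi_lambda _ fun i =>
    Nat.measurable_floor.comp (measurable_toMeasure_apply (hA i)).ennreal_toReal
  have hNω : ∀ ω : Configuration X, ω.points.Finite → ∀ i, N ω i = (ω.points ∩ A i).ncard :=
    fun ω hω i => by simp only [N, measureReal_toMeasure hω (hA i), Nat.floor_natCast]
  have hlaw : π.map N = Measure.pi fun i => poissonMeasure (σ (A i)).toNNReal := by
    refine Measure.ext_of_singleton fun k => ?_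
    rw [Measure.map_apply hN (measurableSet_singleton k), ← hπ.measure_counts_eq hA hd k]
    refine measure_congr ?_
    filter_upwards [hπ.ae_finite] with ω hω
    refine propext ?_
    change N ω = k ↔ ∀ i, ω.toMeasure (A i) = (k i : ENNReal)
    rw [funext_iff]
    refine forall_congr' fun i => ?_
    rw [hNω ω hω i, toMeasure_apply_of_finite hω (hA i), Nat.cast_inj]
  calc ∫ ω, Complex.exp ((∑ i, v i * ω.toMeasure.real (A i) : ℝ) * Complex.I) ∂π
      = ∫ ω, ∏ i, Complex.exp ((v i * N ω i : ℝ) * Complex.I) ∂π := by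
        refine integral_congr_ae ?_
        filter_upwards [hπ.ae_finite] with ω hω
        rw [← Complex.exp_sum, ← Finset.sum_mul, ← Complex.ofReal_sum]
        simp only [hNω ω hω, measureReal_toMeasure hω (hA _)]
    _ = ∫ k, ∏ i, Complex.exp ((v i * (k i : ℕ) : ℝ) * Complex.I)
          ∂Measure.pi fun i => poissonMeasure (σ (A i)).toNNReal := by
        rw [← hlaw, integral_map hN.aemeasurable Measurable.of_discrete.aestronglyMeasurable]
    _ = ∏ i, Complex.exp (σ.real (A i) * (Complex.exp (v i * Complex.I) - 1)) := by
        rw [integral_fintype_prod_eq_prod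
          (f := fun i (k : ℕ) => Complex.exp ((v i * k : ℝ) * Complex.I))]
        simp only [integral_exp_poissonMeasure]
        rfl
    _ = _ := (Complex.exp_sum _ _).symm

/-- The law of the counts is the compound Poisson law whose jumps are the additions of single
points. Both have the same characteristic functions: a linear combination of counts is a linear
combination of the counts of the atoms of the algebra generated by finitely many sets. -/
theorem map_counts [IsFiniteMeasure σ] (hπ : IsPoissonMeasure σ π) :
    π.map counts = compoundPoisson (σ.map pointCounts) := by
  classical
  have := hπ.isProbabilityMeasure
  have : IsProbabilityMeasure (π.map counts) :=
    Measure.isProbabilityMeasure_map measurable_counts.aemeasurable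
  refine IsProjectiveLimit.unique (P := fun I => (π.map counts).map I.restrict)
    (fun I => rfl) fun I => ?_
  have hres : Measurable (I.restrict : CountSpace X → _) := I.measurable_restrict
  refine Measure.ext_of_charFunDual (funext fun L => ?_)
  have hL : ∀ c : CountSpace X, L (I.restrict c) = ∑ j : I, L (Pi.single j 1) * c j := fun c => by
    conv_lhs => rw [← Finset.univ_sum_single (I.restrict c), map_sum]
    refine Finset.sum_congr rfl fun j _ => ?_
    have : (Pi.single j (I.restrict c j) : I → ℝ) = c j • Pi.single j 1 := by
      rw [← Pi.single_smul, smul_eq_mul, mul_one]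
      rfl
    rw [this, map_smul, smul_eq_mul, mul_comm]
  set u : I → ℝ := fun j => L (Pi.single j 1) with hu
  -- `b` encodes to which of the sets a point belongs
  let b : X → I → Bool := fun x j => decide (x ∈ j.1.1)
  have hb : Measurable b := measurable_pi_lambda _ fun j =>
    measurable_to_bool (by
      have : (fun x => decide (x ∈ j.1.1)) ⁻¹' {true} = j.1.1 := by ext x; simp
      rw [this]
      exact j.1.2)
  let v : (I → Bool) → ℝ := fun T => ∑ j, u j * if T j then 1 else 0
  have hv : ∀ x, v (b x) = ∑ j, u j * pointCounts x j.1 := fun x => by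
    simp [v, b, pointCounts, Set.indicator_apply]
  let A : (I → Bool) → Set X := fun T => b ⁻¹' {T}
  have hA : ∀ T, MeasurableSet (A T) := fun T => hb (measurableSet_singleton T)
  have hd : Pairwise fun S T => Disjoint (A S) (A T) := fun S T hST =>
    (Set.disjoint_singleton.2 hST).preimage b
  have hatoms : ∀ ω : Configuration X, ω.points.Finite →
      ∑ j, u j * counts ω j.1 = ∑ T, v T * ω.toMeasure.real (A T) := fun ω hω => by
    have := isFiniteMeasure_toMeasure hω
    have h1 := integral_comp_of_fintype ω.toMeasure hb v
    simp only [hv, smul_eq_mul] at h1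
    have hi : ∀ j : I, Integrable (fun x => u j * pointCounts x j.1) ω.toMeasure := fun j =>
      ((integrable_const (1 : ℝ)).indicator j.1.2).const_mul (u j)
    rw [integral_finsetSum _ fun j _ => hi j] at h1
    simp only [mul_comm (v _)]
    rw [← h1]
    refine Finset.sum_congr rfl fun j _ => ?_
    rw [integral_const_mul]
    congr 1
    exact (integral_indicator_one j.1.2).symm
  have hmeas : Measurable fun c : CountSpace X => (∑ j, u j * c j.1 : ℝ) :=
    Finset.measurable_fun_sum _ fun j _ => (measurable_pi_apply _).const_mul _
  have hχ : Measurable fun c : CountSpace X =>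
      Complex.exp ((∑ j, u j * c j.1 : ℝ) * Complex.I) :=
    ((Complex.measurable_ofReal.comp hmeas).mul_const _).cexp
  have hint : ∀ μ : Measure (CountSpace X), charFunDual (μ.map I.restrict) L =
      ∫ c, Complex.exp ((∑ j, u j * c j.1 : ℝ) * Complex.I) ∂μ := fun μ => by
    rw [charFunDual_apply, integral_map hres.aemeasurable
      (Measurable.aestronglyMeasurable (by fun_prop))]
    simp only [hL, hu]
  rw [hint, hint, integral_map measurable_counts.aemeasurable hχ.aestronglyMeasurable,
    integral_compoundPoisson_of_map_add _ hχ.stronglyMeasurable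
      (fun c => (Complex.norm_exp_ofReal_mul_I _).le) (by simp)
      (fun c d => by
        rw [← Complex.exp_add, ← add_mul, ← Complex.ofReal_add, ← Finset.sum_add_distrib]
        simp only [Pi.add_apply, mul_add]),
    integral_map measurable_pointCounts.aemeasurable hχ.aestronglyMeasurable,
    map_measureReal_apply measurable_pointCounts MeasurableSet.univ, Set.preimage_univ]
  have hσ : σ.real Set.univ = ∑ T, σ.real (A T) := by
    have := integral_comp_of_fintype σ hb fun _ => (1 : ℝ)
    simpa using this
  simp only [← hv]
  rw [integral_comp_of_fintype σ hb fun T => Complex.exp (v T * Complex.I), hσ,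
    Complex.ofReal_sum, ← Finset.sum_sub_distrib]
  have hae : ∀ᵐ ω ∂π, Complex.exp ((∑ j, u j * counts ω j.1 : ℝ) * Complex.I) =
      Complex.exp ((∑ T, v T * ω.toMeasure.real (A T) : ℝ) * Complex.I) := by
    filter_upwards [hπ.ae_finite] with ω hω
    rw [hatoms ω hω]
  rw [integral_congr_ae hae, hπ.integral_exp_counts hA hd v]
  congr 1
  refine Finset.sum_congr rfl fun T _ => ?_
  rw [Complex.real_smul]
  ring

end IsPoissonMeasure

end Configuration

end

theorem mainTheorem2 {X : Type*} [MetricSpace X] [MeasurableSpace X] [BorelSpace X]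
    (σ : Measure X) [IsFiniteMeasure σ] [NullSingletonClass σ]
    (π : Measure (Configuration X)) (hπ : Configuration.IsPoissonMeasure σ π)
    (F : Configuration X → ℝ) (hF : Measurable F) (hF01 : ∀ ω, F ω ∈ Set.Icc (0 : ℝ) 1) :
    gaussianIsoperimetric (∫ ω, F ω ∂π) ≤
      ∫ ω, Real.sqrt (gaussianIsoperimetric (F ω) ^ 2 +
        2 * ∫ x, Configuration.gradient F ω x ^ 2 ∂σ) ∂π := by
  obtain ⟨G₀, hG₀, hFG₀⟩ := Configuration.exists_measurable_comp_counts hF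
  -- `G₀` is arbitrary on functions which are not counts, hence the truncation to `[0, 1]`
  let G : Configuration.CountSpace X → ℝ := fun c => max 0 (min 1 (G₀ c))
  have hG : Measurable G := measurable_const.max (measurable_const.min hG₀)
  have hG01 : ∀ c, G c ∈ Set.Icc (0 : ℝ) 1 := fun c =>
    ⟨le_max_left _ _, max_le zero_le_one (min_le_left _ _)⟩
  have hFG : ∀ ω : Configuration X, ω.points.Finite → F ω = G (Configuration.counts ω) :=
    fun ω hω => by
      simp only [G]
      rw [← hFG₀ ω hω, min_eq_right (hF01 ω).2, max_eq_right (hF01 ω).1]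
  have key := gaussianIsoperimetric_integral_compoundPoisson_le
    (σ.map Configuration.pointCounts) hG hG01
  have hmeas : Measurable fun c => √(gaussianIsoperimetric (G c) ^ 2 +
      2 * ∫ y, (G (c + y) - G c) ^ 2 ∂σ.map Configuration.pointCounts) :=
    (((continuous_gaussianIsoperimetric.measurable.comp hG).pow_const 2).add
      ((BoundedMeasurable.measurable_integral_increment_sq _
        (BoundedMeasurable.ofIcc hG hG01)).const_mul 2)).sqrt
  rw [← hπ.map_counts,
    integral_map Configuration.measurable_counts.aemeasurable hG.aestronglyMeasurable,
    integral_map Configuration.measurable_counts.aemeasurable hmeas.aestronglyMeasurable] at key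
  have hl : ∫ ω, F ω ∂π = ∫ ω, G (Configuration.counts ω) ∂π :=
    integral_congr_ae (hπ.ae_finite.mono hFG)
  rw [hl]
  refine key.trans_eq (integral_congr_ae ?_)
  filter_upwards [hπ.ae_finite] with ω hω
  have hsq : Measurable fun y =>
      (G (Configuration.counts ω + y) - G (Configuration.counts ω)) ^ 2 :=
    ((hG.comp (measurable_const_add _)).sub_const _).pow_const 2
  rw [hFG ω hω, integral_map Configuration.measurable_pointCounts.aemeasurable
    hsq.aestronglyMeasurable]
  congr 3
  refine integral_congr_ae ?_
  -- the points of `ω` form a null set, so only additions of points contribute to the gradient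
  filter_upwards [measure_eq_zero_iff_ae_notMem.1 (ω.countable_points.measure_zero σ)] with x hx
  rw [Configuration.gradient, if_neg hx, hFG ω hω, hFG (ω.addPoint x) (hω.insert x),
    Configuration.counts_addPoint hω hx]
  ring
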